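/- Let $d\ge 2$ and consider the bipartite system $\mathbb C^d\otimes\mathbb C^d$. For a set $\mathbf M$ of discrete POVMs $(M_k)_{k=1}^n$ put $\|\xi\|_{\mathbf M}=\sup_{(M_k)\in\mathbf M}\sum_k|\operatorname{tr}(\xi M_k)|$; the optimal bias with which measurements in $\mathbf M$ discriminate two states $\rho,\sigma$ is $\frac12\|\rho-\sigma\|_{\mathbf M}$. Let $\mathbb M$ be the closed convex hull of the operators $2\sum_{k\in I}M_k-\mathbb 1$ with $(M_k)_{k=1}^n\in\mathbf M$ and $I\subseteq\{1,\dots,n\}$, let $\|\xi\|_{\mathbb M}=\max_{X\in\mathbb M}|\operatorname{tr}(\xi X)|$, and let $\lambda(\mathbb M)$ be the largest $\lambda$ such that $\lambda\|\xi\|_1\le\|\xi\|_{\mathbb M}$ for all traceless Hermitian $\xi$, where $\|\cdot\|_1$ is the trace norm. Let $\mathbf{LO}$ be the set of tensor products $(A_i\otimes B_j)_{i,j}$ of a POVM $(A_i)$ and a POVM $(B_j)$ on $\mathbb C^d$; $\mathbf{LOCC}$ the set of POVMs implemented by finitely many rounds of local operations and classical communication; $\mathbf{SEP}$ the set of POVMs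 of the form $(A_k\otimes B_k)_k$ with $A_k,B_k\ge 0$; and $\mathbf{PPT}$ the set of POVMs whose elements stay positive semidefinite under transposition of any subset of the two parties. Let $\lambda(\mathcal U\otimes\mathcal U)$ be the largest $\lambda$ such that $$\lambda\|\xi\|_1\le d^2\iint\bigl|\operatorname{tr}\bigl(\xi\,(|\psi\rangle\langle\psi|\otimes|\varphi\rangle\langle\varphi|)\bigr)\bigr|\,d\psi\,d\varphi$$ for all traceless Hermitian $\xi$, where $d\psi$ and $d\varphi$ are the normalised uniform distribution on the unit vectors of $\mathbb C^d$; that is, the constant of the tensor product of two isotropic POVMs. Then $$\frac{1}{\sqrt{153}\,d}\le\lambda(\mathcal U\otimes\mathcal U)\le\lambda(\mathbb{LO})\le\lambda(\mathbb{LOCC})\le\lambda(\mathbb{SEP})\le\lambda(\mathbb{PPT})\le\frac{2}{d+1},$$ and moreover $\frac1d\le\lambda(\mathbb{SEP})$. In terms of bias: for any two orthogonal states $\rho,\sigma$ (states with $\rho\sigma=0$) on $\mathbb C^d\otimes\mathbb C^d$ the optimal LOCC bias is at least $\frac{1}{\sqrt{153}\,d}$, while for the orthogonal states $\frac{\mathbb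 1+F}{d(d+1)}$ and $\frac{\mathbb 1-F}{d(d-1)}$ ($F$ the swap operator), i.e. the normalised projectors onto the symmetric and the antisymmetric subspace, it is at most $\frac{2}{d+1}$. Consequently, as $d\to\infty$, $\lambda(\mathbb{LOCC})$, the infimum of the optimal LOCC bias over all pairs of orthogonal states, and the optimal LOCC bias for the symmetric/antisymmetric pair are all $\Theta(1/d)$; so up to a constant factor this pair is optimal for data hiding. -/

import Mathlib

open MeasureTheory Filter Asymptotics
open scoped Matrix Kronecker ComplexOrder

noncomputable section

namespace LocalMeas

/-- Operators on the finite-dimensional Hilbert space with orthonormal basis indexed by `ι`. -/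
abbrev Op (ι : Type) : Type := Matrix ι ι ℂ

/-- Index set of the product basis of `ℂᵃ ⊗ ℂᵇ`. -/
abbrev Bi (a b : ℕ) : Type := Fin a × Fin b

section General

variable {ι : Type} [Fintype ι] [DecidableEq ι]

/-- The trace norm `‖X‖₁ = tr √(X† X)`, the sum of the singular values of `X`. -/
def traceNorm (X : Op ι) : ℝ :=
  ∑ i, Real.sqrt ((Matrix.isHermitian_conjTranspose_mul_self X).eigenvalues i)

/-- Quantum states: positive semidefinite operators of trace one. -/
def IsState (ρ : Op ι) : Prop := ρ.PosSemidef ∧ ρ.trace = 1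

/-- Discrete POVMs `(M₁, …, Mₙ)`. -/
def IsPOVM {n : ℕ} (M : Fin n → Op ι) : Prop :=
  (∀ k, (M k).PosSemidef) ∧ ∑ k, M k = 1

/-- A set of discrete POVMs, given for each number `n` of outcomes. -/
abbrev POVMSet (ι : Type) : Type := (n : ℕ) → Set (Fin n → Op ι)

/-- `‖ℳ(ξ)‖₁ = ∑ₖ |tr (ξ Mₖ)|` for the measurement map `ℳ` of a discrete POVM. -/
def outcomeNorm {n : ℕ} (M : Fin n → Op ι) (ξ : Op ι) : ℝ :=
  ∑ k, ‖(ξ * M k).trace‖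

/-- The norm `‖ξ‖_𝐌 = sup_{(Mₖ) ∈ 𝐌} ‖ℳ(ξ)‖₁` of a set `𝐌` of POVMs. -/
def povmSetNorm (C : POVMSet ι) (ξ : Op ι) : ℝ :=
  sSup {r : ℝ | ∃ (n : ℕ) (M : Fin n → Op ι), M ∈ C n ∧ r = outcomeNorm M ξ}

/-- The optimal bias `½ ‖ρ - σ‖_𝐌` in discriminating `ρ` from `σ` with measurements in `𝐌`. -/
def optimalBias (C : POVMSet ι) (ρ σ : Op ι) : ℝ := povmSetNorm C (ρ - σ) / 2

/-- The smallest optimal bias over all pairs of orthogonal states. -/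
def worstBias (C : POVMSet ι) : ℝ :=
  sInf {r : ℝ | ∃ ρ σ : Op ι, IsState ρ ∧ IsState σ ∧ ρ * σ = 0 ∧ r = optimalBias C ρ σ}

/-- The convex body `𝕄` of a set `𝐌` of POVMs: the closed convex hull of the operators `2M - 1`
with `(M, 1 - M)` obtained by grouping the outcomes of a POVM in `𝐌`. -/
def body (C : POVMSet ι) : Set (Op ι) :=
  closure (convexHull ℝ {X : Op ι | ∃ (n : ℕ) (M : Fin n → Op ι) (I : Finset (Fin n)),
    M ∈ C n ∧ X = (2 : ℂ) • (∑ k ∈ I, M k) - 1})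

/-- The norm `‖ξ‖_𝕄 = max_{X ∈ 𝕄} |tr (ξ X)|` of a convex body. -/
def bodyNorm (K : Set (Op ι)) (ξ : Op ι) : ℝ :=
  sSup {r : ℝ | ∃ X ∈ K, r = ‖(ξ * X).trace‖}

/-- The lower constant of domination of a norm `N` with respect to the trace norm: the largest
`c` with `c ‖ξ‖₁ ≤ N ξ` for all traceless Hermitian `ξ`. -/
def lowerDomination (N : Op ι → ℝ) : ℝ :=
  sSup {c : ℝ | ∀ ξ : Op ι, ξ.IsHermitian → ξ.trace = 0 → c * traceNorm ξ ≤ N ξ}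

/-- `λ(𝕄)`, where `𝕄` is the convex body of the set `𝐌` of POVMs. -/
def lamSet (C : POVMSet ι) : ℝ := lowerDomination (bodyNorm (body C))

/-- `‖ℳ(ξ)‖₁ = ∫ |tr (ξ M(ω))| dμ(ω)` for a continuous POVM `(M(ω) dμ(ω))`. -/
def continuousOutcomeNorm {Ω : Type} [MeasurableSpace Ω] (μ : Measure Ω) (M : Ω → Op ι)
    (ξ : Op ι) : ℝ :=
  ∫ ω, ‖(ξ * M ω).trace‖ ∂μ

/-- `λ(ℳ)` for a single continuous POVM `(M(ω) dμ(ω))`. -/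
def lamPOVM {Ω : Type} [MeasurableSpace Ω] (μ : Measure Ω) (M : Ω → Op ι) : ℝ :=
  lowerDomination (continuousOutcomeNorm μ M)

end General

/-! The isotropic POVM -/

/-- Unit vectors of `ℂᵈ`. -/
abbrev UnitVec (d : ℕ) : Type := Metric.sphere (0 : EuclideanSpace ℂ (Fin d)) 1

/-- The normalised uniform (unitarily invariant) distribution on unit vectors. -/
def uniformUnit (d : ℕ) : Measure (UnitVec d) :=
  ((volume : Measure (EuclideanSpace ℂ (Fin d))).toSphere Set.univ)⁻¹ •
    (volume : Measure (EuclideanSpace ℂ (Fin d))).toSphere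

/-- The density `d |ψ⟩⟨ψ|` of the isotropic POVM on `ℂᵈ` with respect to the uniform
distribution. -/
def isotropic (d : ℕ) (ψ : UnitVec d) : Op (Fin d) :=
  (d : ℂ) • Matrix.vecMulVec (fun i => ψ.1 i) (fun i => star (ψ.1 i))

/-- `λ(𝒰 ⊗ 𝒰)` on `ℂᵈ ⊗ ℂᵈ`, for `𝒰` the isotropic POVM on `ℂᵈ`. -/
def lamUU (d : ℕ) : ℝ :=
  lamPOVM ((uniformUnit d).prod (uniformUnit d))
    (fun ω : UnitVec d × UnitVec d => isotropic d ω.1 ⊗ₖ isotropic d ω.2)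

/-! Locality-restricted measurements on `ℂᵃ ⊗ ℂᵇ` -/

/-- Local measurements: tensor products of a POVM of Alice and a POVM of Bob. -/
def LO (a b : ℕ) : POVMSet (Bi a b) := fun n =>
  {M | ∃ (p q : ℕ) (A : Fin p → Op (Fin a)) (B : Fin q → Op (Fin b)) (e : Fin n ≃ Fin p × Fin q),
    IsPOVM A ∧ IsPOVM B ∧ ∀ k, M k = A (e k).1 ⊗ₖ B (e k).2}

/-- `IsLOCC a b n M`: the POVM `M` with `n` outcomes on `ℂᵃ ⊗ ℂᵇ` is implemented by a protocol of
local operations and classical communication with finitely many rounds. Either the parties stop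
and announce an outcome, or one of them performs a quantum instrument with Kraus operators `K i`
on their share, whose dimension may change, tells the result `i` to the other one, and they go on
with a protocol that depends on `i`. -/
inductive IsLOCC : (a b n : ℕ) → (Fin n → Op (Bi a b)) → Prop
  | announce (a b n : ℕ) (k : Fin n) : IsLOCC a b n (fun j => if j = k then 1 else 0)
  | alice (a b n m : ℕ) (a' : Fin m → ℕ) (K : (i : Fin m) → Matrix (Fin (a' i)) (Fin a) ℂ)
      (hK : ∑ i, (K i)ᴴ * K i = 1)
      (N : (i : Fin m) → Fin n → Op (Bi (a' i) b)) (hN : ∀ i, IsLOCC (a' i) b n (N i)) :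
      IsLOCC a b n (fun k => ∑ i,
        (K i ⊗ₖ (1 : Op (Fin b)))ᴴ * N i k * (K i ⊗ₖ (1 : Op (Fin b))))
  | bob (a b n m : ℕ) (b' : Fin m → ℕ) (K : (i : Fin m) → Matrix (Fin (b' i)) (Fin b) ℂ)
      (hK : ∑ i, (K i)ᴴ * K i = 1)
      (N : (i : Fin m) → Fin n → Op (Bi a (b' i))) (hN : ∀ i, IsLOCC a (b' i) n (N i)) :
      IsLOCC a b n (fun k => ∑ i,
        ((1 : Op (Fin a)) ⊗ₖ K i)ᴴ * N i k * ((1 : Op (Fin a)) ⊗ₖ K i))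

/-- LOCC measurements. -/
def LOCC (a b : ℕ) : POVMSet (Bi a b) := fun n => {M : Fin n → Op (Bi a b) | IsLOCC a b n M}

/-- Separable POVMs. -/
def SEP (a b : ℕ) : POVMSet (Bi a b) := fun n =>
  {M | ∃ (A : Fin n → Op (Fin a)) (B : Fin n → Op (Fin b)),
    (∀ k, (A k).PosSemidef) ∧ (∀ k, (B k).PosSemidef) ∧ (∀ k, M k = A k ⊗ₖ B k) ∧ ∑ k, M k = 1}

/-- Partial transpose on Alice's side. -/
def transposeA {a b : ℕ} (X : Op (Bi a b)) : Op (Bi a b) :=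
  Matrix.of fun p q => X (q.1, p.2) (p.1, q.2)

/-- Partial transpose on Bob's side. -/
def transposeB {a b : ℕ} (X : Op (Bi a b)) : Op (Bi a b) :=
  Matrix.of fun p q => X (p.1, q.2) (q.1, p.2)

/-- PPT POVMs: the elements remain positive under transposition of any subset of the parties. -/
def PPT (a b : ℕ) : POVMSet (Bi a b) := fun _ =>
  {M | IsPOVM M ∧ ∀ k, (transposeA (M k)).PosSemidef ∧ (transposeB (M k)).PosSemidef ∧
    ((M k)ᵀ).PosSemidef}

/-! The data hiding states -/

/-- The swap operator `F` on `ℂᵈ ⊗ ℂᵈ`. -/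
def swapOp (d : ℕ) : Op (Bi d d) :=
  Matrix.of fun p q => if p.1 = q.2 ∧ p.2 = q.1 then 1 else 0

/-- The symmetric state `(1 + F) / (d (d + 1))`. -/
def symState (d : ℕ) : Op (Bi d d) := ((d : ℂ) * ((d : ℂ) + 1))⁻¹ • (1 + swapOp d)

/-- The antisymmetric state `(1 - F) / (d (d - 1))`. -/
def antisymState (d : ℕ) : Op (Bi d d) := ((d : ℂ) * ((d : ℂ) - 1))⁻¹ • (1 - swapOp d)

end LocalMeas

end

open LocalMeas

noncomputable section

namespace LocalMeas

/-! ### Gaussian moments -/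

/-! Both lower bounds pass through the Hilbert–Schmidt norm. Since ‖ξ‖₁ ≤ d‖ξ‖₂ on a space of
dimension d², it suffices to bound a measurement norm from below by a dimension-free multiple of
‖ξ‖₂.

For two isotropic POVMs the outcome norm is controlled by d² E|q|, where q(ψ,φ) = ⟨ψφ|ξ|ψφ⟩ on a
product of two spheres. A first moment is large as soon as the fourth moment is comparable with the
square of the second (`sqrt_second_moment_le`). On one sphere the moments of a quadratic form are
explicit: in Gaussian coordinates that diagonalise it they are symmetric functions of the
eigenvalues, and E q⁴ ≤ K (E q²)² with K < 12. This tensorises with constant K²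
(`prod_fourth_moment_le`), while E q² ≥ ‖ξ‖₂²/(d(d+1))² (`frobSq_le_prod_moment`). The outcome norm
is therefore at least ‖ξ‖₂/12, slightly better than the ‖ξ‖₂/√153 that is needed. Cutting the sphere
into small cells turns the isotropic POVMs into discrete local ones
(`continuousOutcomeNorm_le_bodyNorm_LO`).

The chain of classes is elementary, except that an LOCC measurement is only a coarse-graining of a
separable one (`isSepGrouping_of_isLOCC`).

For separable measurements the operators 1 ± Δ are separable whenever Δ is traceless Hermitian with
‖Δ‖₂ ≤ 1, so Δ itself lies in the convex body. By Hahn–Banach this reduces to ‖W‖₂ ≤ tr W for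
block-positive W (`frobSq_le_sq_trace_of_blockPositive`), which is proved block by block.

For the upper bound, tr(F X) is the expectation of the partial transpose of X in an unnormalised
maximally entangled vector. It is thus nonnegative on PPT operators, and PPT measurements hardly
distinguish the symmetric from the antisymmetric state. Orthogonal states satisfy ‖ρ − σ‖₁ = 2,
which cancels the ½ in the bias. -/

theorem integral_norm_sq_pow_gaussian (k : ℕ) :
    ∫ z : ℂ, (‖z‖ ^ 2) ^ k * Real.exp (-‖z‖ ^ 2) = Real.pi * k.factorial := by
  have h := Complex.integral_rpow_mul_exp_neg_rpow (p := 2) (q := ((2 * k : ℕ) : ℝ)) (by norm_num)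
    (by have : (0:ℝ) ≤ ((2 * k : ℕ) : ℝ) := Nat.cast_nonneg _
        linarith)
  simp only [Real.rpow_natCast, Real.rpow_two] at h
  simp only [← pow_mul]
  rw [h]
  have : ((2 * k : ℕ) + 2 : ℝ) / 2 = k + 1 := by push_cast; ring
  rw [this, Real.Gamma_nat_eq_factorial]
  ring

theorem integrable_norm_sq_pow_gaussian (k : ℕ) :
    Integrable (fun z : ℂ => (‖z‖ ^ 2) ^ k * Real.exp (-‖z‖ ^ 2)) := by
  -- The integral of a non-integrable function is 0 by convention, so the nonzero value just
  -- computed certifies integrability.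
  refine not_imp_comm.1 integral_undef ?_
  rw [integral_norm_sq_pow_gaussian]
  positivity

/-- The `k`-th moment of `∑ hᵢ |xᵢ|²` for the Gaussian weight `exp (-∑ |xᵢ|²)`. -/
def gaussMoment {n : ℕ} (h : Fin n → ℝ) (k : ℕ) : ℝ :=
  ∫ x : Fin n → ℂ, (∑ i, h i * ‖x i‖ ^ 2) ^ k * Real.exp (-∑ i, ‖x i‖ ^ 2)

theorem gauss_succ_expand {n : ℕ} (h : Fin (n + 1) → ℝ) (k : ℕ) (z : ℂ) (x : Fin n → ℂ) :
    (∑ i, h i * ‖(Fin.cons z x : Fin (n + 1) → ℂ) i‖ ^ 2) ^ k *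
        Real.exp (-∑ i, ‖(Fin.cons z x : Fin (n + 1) → ℂ) i‖ ^ 2) =
      ∑ j ∈ Finset.range (k + 1), (k.choose j * h 0 ^ j) *
        (((‖z‖ ^ 2) ^ j * Real.exp (-‖z‖ ^ 2)) *
        ((∑ i, h i.succ * ‖x i‖ ^ 2) ^ (k - j) * Real.exp (-∑ i, ‖x i‖ ^ 2))) := by
  simp only [Fin.sum_univ_succ, Fin.cons_zero, Fin.cons_succ]
  rw [neg_add, Real.exp_add, add_pow, Finset.sum_mul]
  refine Finset.sum_congr rfl fun j _ => ?_
  rw [mul_pow]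
  ring

theorem gauss_succ_symm {n : ℕ} (p : ℂ × (Fin n → ℂ)) :
    (MeasurableEquiv.piFinSuccAbove (fun _ : Fin (n + 1) => ℂ) 0).symm p = Fin.cons p.1 p.2 := by
  simp [MeasurableEquiv.piFinSuccAbove, Fin.insertNthEquiv]

theorem integrable_gauss {n : ℕ} (h : Fin n → ℝ) (k : ℕ) :
    Integrable (fun x : Fin n → ℂ =>
      (∑ i, h i * ‖x i‖ ^ 2) ^ k * Real.exp (-∑ i, ‖x i‖ ^ 2)) := by
  induction n generalizing k with
  | zero =>
    have : IsFiniteMeasure (volume : Measure (Fin 0 → ℂ)) := by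
      rw [volume_pi, Measure.pi_of_empty]; infer_instance
    simp only [Finset.univ_eq_empty, Finset.sum_empty]
    exact integrable_const _
  | succ n ih =>
    have hm := (volume_preserving_piFinSuccAbove (fun _ : Fin (n + 1) => ℂ) 0).symm
    rw [← hm.integrable_comp_emb (MeasurableEquiv.measurableEmbedding _)]
    have : (fun x : Fin (n + 1) → ℂ => (∑ i, h i * ‖x i‖ ^ 2) ^ k *
        Real.exp (-∑ i, ‖x i‖ ^ 2)) ∘
        (MeasurableEquiv.piFinSuccAbove (fun _ : Fin (n + 1) => ℂ) 0).symm =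
        fun p : ℂ × (Fin n → ℂ) => ∑ j ∈ Finset.range (k + 1), (k.choose j * h 0 ^ j) *
        (((‖p.1‖ ^ 2) ^ j * Real.exp (-‖p.1‖ ^ 2)) *
        ((∑ i, h i.succ * ‖p.2 i‖ ^ 2) ^ (k - j) * Real.exp (-∑ i, ‖p.2 i‖ ^ 2))) := by
      funext p
      rw [Function.comp_apply, gauss_succ_symm, gauss_succ_expand]
    rw [this]
    exact integrable_finsetSum _ fun j _ =>
      ((integrable_norm_sq_pow_gaussian j).mul_prod (ih (fun i => h i.succ) (k - j))).const_mul _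

theorem gaussMoment_succ {n : ℕ} (h : Fin (n + 1) → ℝ) (k : ℕ) :
    gaussMoment h k = ∑ j ∈ Finset.range (k + 1), (k.choose j * h 0 ^ j) *
      (Real.pi * j.factorial * gaussMoment (fun i => h i.succ) (k - j)) := by
  have hm := (volume_preserving_piFinSuccAbove (fun _ : Fin (n + 1) => ℂ) 0).symm
  unfold gaussMoment
  rw [← hm.integral_comp (MeasurableEquiv.measurableEmbedding _)]
  simp only [gauss_succ_symm, gauss_succ_expand]
  rw [integral_finsetSum]
  · refine Finset.sum_congr rfl fun j _ => ?_
    rw [integral_const_mul]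
    congr 1
    rw [← integral_norm_sq_pow_gaussian]
    exact integral_prod_mul (μ := (volume : Measure ℂ)) (ν := (volume : Measure (Fin n → ℂ)))
      (fun z : ℂ => (‖z‖ ^ 2) ^ j * Real.exp (-‖z‖ ^ 2)) (fun x : Fin n → ℂ =>
      (∑ i, h i.succ * ‖x i‖ ^ 2) ^ (k - j) * Real.exp (-∑ i, ‖x i‖ ^ 2))
  · exact fun j _ => ((integrable_norm_sq_pow_gaussian j).mul_prod
      (integrable_gauss (fun i => h i.succ) (k - j))).const_mul _

/-- Under the Gaussian weight the |xᵢ|² are independent exponential variables, so the k-th moment is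
πⁿ k! times the complete homogeneous symmetric polynomial of degree k, here written in power sums.
The induction splits off one coordinate. -/
theorem gaussMoment_eq {n : ℕ} (h : Fin n → ℝ) :
    gaussMoment h 0 = Real.pi ^ n ∧ gaussMoment h 1 = Real.pi ^ n * ∑ i, h i ∧
    gaussMoment h 2 = Real.pi ^ n * ((∑ i, h i) ^ 2 + ∑ i, h i ^ 2) ∧
    gaussMoment h 3 = Real.pi ^ n * ((∑ i, h i) ^ 3 + 3 * (∑ i, h i) * (∑ i, h i ^ 2) +
      2 * ∑ i, h i ^ 3) ∧
    gaussMoment h 4 = Real.pi ^ n * ((∑ i, h i) ^ 4 + 6 * (∑ i, h i) ^ 2 * (∑ i, h i ^ 2) +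
      3 * (∑ i, h i ^ 2) ^ 2 + 8 * (∑ i, h i) * (∑ i, h i ^ 3) + 6 * ∑ i, h i ^ 4) := by
  induction n with
  | zero => simp [gaussMoment, volume_pi, measureReal_def]
  | succ n ih =>
    obtain ⟨h0, h1, h2, h3, h4⟩ := ih (fun i => h i.succ)
    simp only [gaussMoment_succ h, Finset.sum_range_succ, Finset.sum_range_zero, h0, h1, h2, h3, h4,
      Fin.sum_univ_succ, Nat.sub_self, Nat.sub_zero, Nat.reduceSub]
    refine ⟨?_, ?_, ?_, ?_, ?_⟩ <;> simp [Nat.choose, Nat.factorial] <;> ring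

/-! ### Moments of quadratic forms on the unit sphere -/

/-- The quadratic form `Re ⟨x|H|x⟩`. -/
def quadForm {ι : Type} [Fintype ι] (H : Op ι) (x : ι → ℂ) : ℝ := (star x ⬝ᵥ H *ᵥ x).re

/-- The squared Hilbert–Schmidt norm. -/
def frobSq {ι κ : Type} [Fintype ι] [Fintype κ] (X : Matrix ι κ ℂ) : ℝ := ∑ i, ∑ j, ‖X i j‖ ^ 2

theorem frobSq_nonneg {ι κ : Type} [Fintype ι] [Fintype κ] (X : Matrix ι κ ℂ) : 0 ≤ frobSq X :=
  Finset.sum_nonneg fun _ _ => Finset.sum_nonneg fun _ _ => by positivity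

theorem trace_conjTranspose_mul_self {ι κ : Type} [Fintype ι] [Fintype κ] (X : Matrix ι κ ℂ) :
    (Xᴴ * X).trace = (frobSq X : ℂ) := by
  simp only [Matrix.trace, Matrix.diag, Matrix.mul_apply, Matrix.conjTranspose_apply, frobSq]
  rw [Finset.sum_comm]
  push_cast
  refine Finset.sum_congr rfl fun i _ => Finset.sum_congr rfl fun j _ => ?_
  rw [← Complex.conj_mul']
  rfl

theorem quadForm_smul {ι : Type} [Fintype ι] (H : Op ι) (r : ℝ) (x : ι → ℂ) :
    quadForm H (r • x) = r ^ 2 * quadForm H x := by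
  have : (r • x : ι → ℂ) = (r : ℂ) • x := by ext; simp
  rw [quadForm, quadForm, this, Matrix.mulVec_smul, star_smul, smul_dotProduct, dotProduct_smul,
    smul_smul]
  simp [pow_two, ← Complex.ofReal_mul]

theorem quadForm_diagonal {ι : Type} [Fintype ι] [DecidableEq ι] (h : ι → ℝ) (x : ι → ℂ) :
    quadForm (Matrix.diagonal fun i => (h i : ℂ)) x = ∑ i, h i * ‖x i‖ ^ 2 := by
  simp only [quadForm, dotProduct, Matrix.mulVec_diagonal, Complex.re_sum]
  refine Finset.sum_congr rfl fun i _ => ?_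
  simp [Complex.sq_norm, Complex.normSq_apply]
  ring

theorem quadForm_conj {ι κ : Type} [Fintype ι] [Fintype κ] (H : Op κ) (V : Matrix κ ι ℂ)
    (x : ι → ℂ) : quadForm (Vᴴ * H * V) x = quadForm H (V *ᵥ x) := by
  rw [quadForm, quadForm, Matrix.star_mulVec, ← Matrix.dotProduct_mulVec, Matrix.mulVec_mulVec,
    Matrix.mulVec_mulVec, Matrix.mul_assoc]

theorem continuous_quadForm {ι : Type} [Fintype ι] (H : Op ι) : Continuous (quadForm H) := by
  unfold quadForm dotProduct Matrix.mulVec dotProduct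
  simp only [Pi.star_apply]
  fun_prop

section Spectral

variable {ι : Type} [Fintype ι] [DecidableEq ι] {H : Op ι}

theorem hermitian_eq_conj_diagonal (hH : H.IsHermitian) :
    H = ((hH.eigenvectorUnitary : Op ι)ᴴ)ᴴ *
      Matrix.diagonal (fun i => (hH.eigenvalues i : ℂ)) * (hH.eigenvectorUnitary : Op ι)ᴴ := by
  conv_lhs => rw [hH.spectral_theorem]
  rw [Matrix.conjTranspose_conjTranspose]
  rfl

theorem hermitian_mul_self (hH : H.IsHermitian) :
    H * H = (hH.eigenvectorUnitary : Op ι) *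
      Matrix.diagonal (fun i => ((hH.eigenvalues i ^ 2 : ℝ) : ℂ)) *
        (hH.eigenvectorUnitary : Op ι)ᴴ := by
  have hu : (hH.eigenvectorUnitary : Op ι)ᴴ * (hH.eigenvectorUnitary : Op ι) = 1 :=
    (Matrix.mem_unitaryGroup_iff'.1 hH.eigenvectorUnitary.2)
  have h2 : Matrix.diagonal (fun i => ((hH.eigenvalues i ^ 2 : ℝ) : ℂ)) =
      Matrix.diagonal (fun i => (hH.eigenvalues i : ℂ)) *
        Matrix.diagonal (fun i => (hH.eigenvalues i : ℂ)) := by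
    rw [Matrix.diagonal_mul_diagonal]
    simp [pow_two]
  conv_lhs => rw [hermitian_eq_conj_diagonal hH]
  rw [h2, Matrix.conjTranspose_conjTranspose]
  simp only [Matrix.mul_assoc]
  rw [← Matrix.mul_assoc _ᴴ _ (Matrix.diagonal _ * _), hu, Matrix.one_mul]

theorem frobSq_eq_sum_eigenvalues (hH : H.IsHermitian) :
    frobSq H = ∑ i, hH.eigenvalues i ^ 2 := by
  have h1 := trace_conjTranspose_mul_self H
  have hu : (hH.eigenvectorUnitary : Op ι)ᴴ * (hH.eigenvectorUnitary : Op ι) = 1 :=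
    (Matrix.mem_unitaryGroup_iff'.1 hH.eigenvectorUnitary.2)
  rw [hH.eq, hermitian_mul_self hH, Matrix.trace_mul_comm, ← Matrix.mul_assoc, hu,
    Matrix.one_mul, Matrix.trace_diagonal] at h1
  apply Complex.ofReal_injective
  rw [← h1]
  push_cast
  rfl

end Spectral

section Sphere

variable {d : ℕ}

/-- Homogeneity of degree 2k makes the integrand a product in polar coordinates; the origin is a
null set. -/
theorem integral_polar [NeZero d] (k : ℕ) (F : EuclideanSpace ℂ (Fin d) → ℝ)
    (hF : ∀ (r : ℝ) x, F (r • x) = (r ^ 2) ^ k * F x) :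
    ∫ x, F x * Real.exp (-‖x‖ ^ 2) =
      (∫ ψ : UnitVec d, F ψ ∂(volume : Measure (EuclideanSpace ℂ (Fin d))).toSphere) *
      ∫ r : Set.Ioi (0 : ℝ), (r.1 ^ 2) ^ k * Real.exp (-r.1 ^ 2)
        ∂Measure.volumeIoiPow (Module.finrank ℝ (EuclideanSpace ℂ (Fin d)) - 1) := by
  have h1 : ∫ x, F x * Real.exp (-‖x‖ ^ 2) =
      ∫ x : ({(0)}ᶜ : Set (EuclideanSpace ℂ (Fin d))), F x.1 * Real.exp (-‖x.1‖ ^ 2)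
        ∂(volume.comap Subtype.val) := by
    rw [integral_subtype_comap (measurableSet_singleton _).compl
      fun x => F x * Real.exp (-‖x‖ ^ 2), restrict_compl_singleton]
  rw [h1, ← integral_prod_mul, ←
    (volume : Measure (EuclideanSpace ℂ (Fin d))).measurePreserving_homeomorphUnitSphereProd.integral_comp
    (Homeomorph.measurableEmbedding _)]
  refine integral_congr_ae (Eventually.of_forall fun x => ?_)
  have hx : ‖x.1‖ ≠ 0 := norm_ne_zero_iff.2 x.2
  have h2 := hF ‖x.1‖ (‖x.1‖⁻¹ • x.1)
  rw [smul_smul, mul_inv_cancel₀ hx, one_smul] at h2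
  simp only [homeomorphUnitSphereProd_apply_snd_coe, homeomorphUnitSphereProd_apply_fst_coe]
  rw [h2]
  ring

instance isProbabilityMeasure_uniformUnit [NeZero d] : IsProbabilityMeasure (uniformUnit d) := by
  refine ⟨?_⟩
  rw [uniformUnit, Measure.smul_apply, smul_eq_mul]
  refine ENNReal.inv_mul_cancel ?_ (measure_ne_top _ _)
  rw [Ne, Measure.measure_univ_eq_zero]
  exact Measure.toSphere_ne_zero _

/-- Comparing F with ‖x‖²ᵏ, which is 1 on the sphere, eliminates the radial integral and the area of
the sphere, so neither has to be evaluated. -/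
theorem integral_eq_uniformUnit_mul [NeZero d] (k : ℕ) (F : EuclideanSpace ℂ (Fin d) → ℝ)
    (hF : ∀ (r : ℝ) x, F (r • x) = (r ^ 2) ^ k * F x) :
    ∫ x, F x * Real.exp (-‖x‖ ^ 2) = (∫ ψ : UnitVec d, F ψ ∂uniformUnit d) *
      ∫ x : EuclideanSpace ℂ (Fin d), (‖x‖ ^ 2) ^ k * Real.exp (-‖x‖ ^ 2) := by
  have h0 : (volume : Measure (EuclideanSpace ℂ (Fin d))).toSphere.real Set.univ ≠ 0 := by
    rw [measureReal_ne_zero_iff, Ne, Measure.measure_univ_eq_zero]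
    exact Measure.toSphere_ne_zero _
  rw [integral_polar k F hF, integral_polar k (fun x => (‖x‖ ^ 2) ^ k)
    (fun r x => by rw [norm_smul, mul_pow, mul_pow, Real.norm_eq_abs, sq_abs]), uniformUnit,
    integral_smul_measure]
  have : ∀ ψ : UnitVec d, ‖ψ.1‖ = 1 := fun ψ => by simp
  simp only [this, one_pow, integral_const, smul_eq_mul, mul_one, ENNReal.toReal_inv]
  rw [← measureReal_def]
  field_simp

/-- Coordinates in an eigenbasis of H turn both integrals into Gaussian moments. The factor c
compares two Haar measures; it is the same in both identities and cancels in their quotient, so its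
value is irrelevant. -/
theorem exists_integral_diagonalized {H : Op (Fin d)} (hH : H.IsHermitian) :
    ∃ c : ℝ, c ≠ 0 ∧ ∀ k : ℕ,
      ∫ x : EuclideanSpace ℂ (Fin d), quadForm H x.ofLp ^ k * Real.exp (-‖x‖ ^ 2) =
        c * gaussMoment hH.eigenvalues k ∧
      ∫ x : EuclideanSpace ℂ (Fin d), (‖x‖ ^ 2) ^ k * Real.exp (-‖x‖ ^ 2) =
        c * gaussMoment (fun _ : Fin d => 1) k := by
  let T : EuclideanSpace ℂ (Fin d) ≃L[ℝ] (Fin d → ℂ) :=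
    (hH.eigenvectorBasis.repr.toContinuousLinearEquiv.restrictScalars ℝ).trans
      (PiLp.continuousLinearEquiv 2 ℝ fun _ : Fin d => ℂ)
  have hT : ∀ x i, T x i = (hH.eigenvectorBasis.repr x).ofLp i := fun x i => rfl
  have hnorm : ∀ x, ‖x‖ ^ 2 = ∑ i, ‖T x i‖ ^ 2 := fun x => by
    rw [← hH.eigenvectorBasis.repr.norm_map x, EuclideanSpace.norm_sq_eq]
    rfl
  have hTU : ∀ x, T x = (hH.eigenvectorUnitary : Op (Fin d))ᴴ *ᵥ x.ofLp := fun x => by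
    ext i
    rw [hT, OrthonormalBasis.repr_apply_apply, EuclideanSpace.inner_eq_star_dotProduct,
      Matrix.mulVec, dotProduct_comm]
    rfl
  have hq : ∀ x : EuclideanSpace ℂ (Fin d), quadForm H x.ofLp =
      ∑ i, hH.eigenvalues i * ‖T x i‖ ^ 2 := fun x => by
    conv_lhs => rw [hermitian_eq_conj_diagonal hH]
    rw [quadForm_conj, quadForm_diagonal, hTU]
  have := T.isAddHaarMeasure_map volume
  have hmap := Measure.isAddLeftInvariant_eq_smul
    (Measure.map T (volume : Measure (EuclideanSpace ℂ (Fin d)))) volume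
  set c := Measure.addHaarScalarFactor
    (Measure.map T (volume : Measure (EuclideanSpace ℂ (Fin d)))) volume
  have hc : 0 < c := Measure.addHaarScalarFactor_pos_of_isAddHaarMeasure _ _
  have key : ∀ f : (Fin d → ℂ) → ℝ, ∫ x, f (T x) = c * ∫ y, f y := fun f => by
    refine (T.toHomeomorph.measurableEmbedding.integral_map (μ := volume) f).symm.trans ?_
    change ∫ y, f y ∂(Measure.map T volume) = _
    rw [hmap, integral_smul_nnreal_measure]
    rfl
  refine ⟨c, by exact_mod_cast hc.ne', fun k => ⟨?_, ?_⟩⟩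
  · rw [gaussMoment, ← key]
    simp only [hq, hnorm]
  · rw [gaussMoment, ← key]
    simp only [hnorm, one_mul]

/-- The spherical moment is a quotient of two Gaussian moments. For k = 1, 2, 4 the denominator is
π^d times d(d+1)⋯(d+k−1). -/
theorem sphere_moment [NeZero d] {H : Op (Fin d)} (hH : H.IsHermitian) (k : ℕ) :
    gaussMoment hH.eigenvalues k =
      (∫ ψ : UnitVec d, quadForm H ψ.1.ofLp ^ k ∂uniformUnit d) *
        gaussMoment (fun _ : Fin d => 1) k := by
  obtain ⟨c, hc, h⟩ := exists_integral_diagonalized hH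
  have h1 := integral_eq_uniformUnit_mul k (fun x => quadForm H x.ofLp ^ k) (fun r x => by
    rw [WithLp.ofLp_smul, quadForm_smul, mul_pow])
  rw [(h k).1, (h k).2] at h1
  apply mul_left_cancel₀ hc
  rw [h1]
  ring

theorem sphere_second_moment [NeZero d] {H : Op (Fin d)} (hH : H.IsHermitian) :
    (∫ ψ : UnitVec d, quadForm H ψ.1.ofLp ^ 2 ∂uniformUnit d) * (d * (d + 1)) =
      (∑ i, hH.eigenvalues i) ^ 2 + frobSq H := by
  have h := sphere_moment hH 2
  rw [(gaussMoment_eq _).2.2.1, (gaussMoment_eq _).2.2.1] at h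
  have hp : (Real.pi : ℝ) ^ d ≠ 0 := by positivity
  apply mul_left_cancel₀ hp
  rw [frobSq_eq_sum_eigenvalues hH, h]
  simp
  ring

theorem sphere_fourth_moment_le [NeZero d] {H : Op (Fin d)} (hH : H.IsHermitian) :
    (∫ ψ : UnitVec d, quadForm H ψ.1.ofLp ^ 4 ∂uniformUnit d) * (d * (d + 1) * (d + 2) * (d + 3)) ≤
      12 * ((∑ i, hH.eigenvalues i) ^ 2 + frobSq H) ^ 2 := by
  have h := sphere_moment hH 4
  rw [(gaussMoment_eq _).2.2.2.2, (gaussMoment_eq _).2.2.2.2] at h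
  have hp : (Real.pi : ℝ) ^ d ≠ 0 := by positivity
  have h' : (∫ ψ : UnitVec d, quadForm H ψ.1.ofLp ^ 4 ∂uniformUnit d) *
      (d * (d + 1) * (d + 2) * (d + 3)) =
      (∑ i, hH.eigenvalues i) ^ 4 + 6 * (∑ i, hH.eigenvalues i) ^ 2 * (∑ i, hH.eigenvalues i ^ 2) +
      3 * (∑ i, hH.eigenvalues i ^ 2) ^ 2 +
      8 * (∑ i, hH.eigenvalues i) * (∑ i, hH.eigenvalues i ^ 3) +
      6 * ∑ i, hH.eigenvalues i ^ 4 := by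
    apply mul_left_cancel₀ hp
    rw [h]
    simp
    ring
  rw [h', frobSq_eq_sum_eigenvalues hH]
  set l := hH.eigenvalues
  -- Summing 2 lᵢ²(2a − lᵢ)² ≥ 0 over i, with a = ∑ lᵢ, removes the term of indefinite sign.
  have h3 : 8 * (∑ i, l i) * (∑ i, l i ^ 3) ≤
      8 * (∑ i, l i) ^ 2 * (∑ i, l i ^ 2) + 2 * ∑ i, l i ^ 4 := by
    set a := ∑ i, l i
    simp only [Finset.mul_sum, ← Finset.sum_add_distrib]
    refine Finset.sum_le_sum fun i _ => ?_
    nlinarith [mul_nonneg (sq_nonneg (l i)) (sq_nonneg (2 * a - l i))]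
  have h4 : ∑ i, l i ^ 4 ≤ (∑ i, l i ^ 2) ^ 2 := by
    have := Finset.sum_sq_le_sq_sum_of_nonneg (s := Finset.univ) (f := fun i => l i ^ 2)
      (fun i _ => sq_nonneg _)
    simpa [← pow_mul] using this
  have h5 : 0 ≤ ∑ i, l i ^ 2 := Finset.sum_nonneg fun i _ => sq_nonneg _
  -- With a = ∑ lᵢ and b = ∑ lᵢ², the left side is at most a⁴ + 14a²b + 11b², which is below 12(a² +
  -- b)².
  nlinarith [sq_nonneg (∑ i, l i), mul_nonneg (sq_nonneg (∑ i, l i)) h5,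
    sq_nonneg ((∑ i, l i) ^ 2), sq_nonneg (∑ i, l i ^ 2)]

/-- Comparison of the fourth and the second moment. -/
theorem sphere_fourth_le_second_sq [NeZero d] {H : Op (Fin d)} (hH : H.IsHermitian) :
    ∫ ψ : UnitVec d, quadForm H ψ.1.ofLp ^ 4 ∂uniformUnit d ≤
      12 * (d * (d + 1)) / ((d + 2) * (d + 3)) *
        (∫ ψ : UnitVec d, quadForm H ψ.1.ofLp ^ 2 ∂uniformUnit d) ^ 2 := by
  have h4 := sphere_fourth_moment_le hH
  rw [← sphere_second_moment hH] at h4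
  have hd : (0 : ℝ) < d := by exact_mod_cast Nat.pos_of_ne_zero (NeZero.ne d)
  rw [div_mul_eq_mul_div, le_div_iff₀ (by positivity)]
  have hpos : (0 : ℝ) < d * (d + 1) := by positivity
  refine le_of_mul_le_mul_right ?_ hpos
  linarith

end Sphere

/-! ### Moment comparison on product spaces -/

theorem continuous_integral_left {X Y : Type} [TopologicalSpace X] [CompactSpace X]
    [SecondCountableTopology X] [T2Space X] [TopologicalSpace Y] [CompactSpace Y]
    [SecondCountableTopology Y] [T2Space Y] [MeasurableSpace Y] [BorelSpace Y] {ν : Measure Y}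
    [IsFiniteMeasure ν] {f : X → Y → ℝ} (hf : Continuous f.uncurry) :
    Continuous fun x => ∫ y, f x y ∂ν := by
  have := continuous_parametric_integral_of_continuous (μ := ν) hf isCompact_univ
  simpa using this

section Moments

variable {X Y : Type} [TopologicalSpace X] [CompactSpace X] [SecondCountableTopology X]
  [T2Space X] [MeasurableSpace X] [BorelSpace X] [TopologicalSpace Y] [CompactSpace Y]
  [SecondCountableTopology Y] [T2Space Y] [MeasurableSpace Y] [BorelSpace Y]
  {μ : Measure X} {ν : Measure Y} [IsFiniteMeasure μ] [IsFiniteMeasure ν]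

theorem integrable_of_continuous_compact {E : Type} [NormedAddCommGroup E] {f : X → E}
    (hf : Continuous f) : Integrable f μ :=
  hf.integrable_of_hasCompactSupport (HasCompactSupport.of_compactSpace f)

theorem sq_integral_mul_le {a b : X → ℝ} (ha : Continuous a) (hb : Continuous b) :
    (∫ x, a x * b x ∂μ) ^ 2 ≤ (∫ x, a x ^ 2 ∂μ) * ∫ x, b x ^ 2 ∂μ := by
  have h : ∀ t : ℝ, 0 ≤ (∫ x, a x ^ 2 ∂μ) * (t * t) + (-2 * ∫ x, a x * b x ∂μ) * t +
      ∫ x, b x ^ 2 ∂μ := fun t => by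
    have h0 : 0 ≤ ∫ x, (a x ^ 2 * (t * t) + -2 * (a x * b x) * t + b x ^ 2) ∂μ :=
      integral_nonneg fun x => by
        have : a x ^ 2 * (t * t) + -2 * (a x * b x) * t + b x ^ 2 = (a x * t - b x) ^ 2 := by ring
        simp only [this]
        positivity
    rw [integral_add, integral_add, integral_mul_const, integral_mul_const,
      integral_const_mul] at h0
    · exact h0
    all_goals exact integrable_of_continuous_compact (by fun_prop)
  have := discrim_le_zero h
  rw [discrim] at this
  linarith

/-- This is Minkowski's inequality in L²(ν) for g = ∫ f(x,·)² dμ. Pairing g with itself, exchanging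
the integrals and applying Cauchy–Schwarz for each fixed x gives ‖g‖² ≤ √K ‖g‖ ∫∫ f², after which
‖g‖ is divided out unless it vanishes. -/
theorem integral_sq_integral_le {f : X → Y → ℝ} (hf : Continuous f.uncurry) {K : ℝ} (hK : 0 ≤ K)
    (hx : ∀ x, ∫ y, f x y ^ 4 ∂ν ≤ K * (∫ y, f x y ^ 2 ∂ν) ^ 2) :
    ∫ y, (∫ x, f x y ^ 2 ∂μ) ^ 2 ∂ν ≤ K * (∫ x, ∫ y, f x y ^ 2 ∂ν ∂μ) ^ 2 := by
  have hf2 : Continuous (Function.uncurry fun x y => f x y ^ 2) := hf.pow 2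
  have hfx : ∀ x, Continuous (f x) := fun x => hf.comp (Continuous.prodMk_right x)
  have hg : Continuous fun y => ∫ x, f x y ^ 2 ∂μ :=
    continuous_integral_left (f := fun y x => f x y ^ 2) (hf2.comp continuous_swap)
  have hh : Continuous fun x => ∫ y, f x y ^ 2 ∂ν := continuous_integral_left hf2
  set g := fun y => ∫ x, f x y ^ 2 ∂μ with hgdef
  set h := fun x => ∫ y, f x y ^ 2 ∂ν with hhdef
  set G := ∫ y, g y ^ 2 ∂ν
  have hG : 0 ≤ G := integral_nonneg fun _ => sq_nonneg _
  have hm : 0 ≤ ∫ x, h x ∂μ := integral_nonneg fun _ => integral_nonneg fun _ => sq_nonneg _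
  have h1 : G = ∫ x, ∫ y, g y * f x y ^ 2 ∂ν ∂μ := by
    rw [integral_integral_swap]
    · refine integral_congr_ae (Eventually.of_forall fun y => ?_)
      simp only [integral_const_mul]
      rw [pow_two]
    · exact integrable_of_continuous_compact ((hg.comp continuous_snd).mul hf2)
  have h2 : ∀ x, ∫ y, g y * f x y ^ 2 ∂ν ≤ Real.sqrt (G * K) * h x := fun x => by
    have hcs := sq_integral_mul_le (μ := ν) hg ((hfx x).pow 2)
    have hhx : 0 ≤ h x := integral_nonneg fun _ => sq_nonneg _
    apply le_of_sq_le_sq _ (by positivity)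
    rw [mul_pow, Real.sq_sqrt (by positivity), mul_assoc]
    refine hcs.trans (mul_le_mul_of_nonneg_left ?_ hG)
    refine le_trans (le_of_eq ?_) (hx x)
    refine integral_congr_ae (Eventually.of_forall fun y => ?_)
    change (f x y ^ 2) ^ 2 = f x y ^ 4
    ring
  have h3 : G ≤ Real.sqrt (G * K) * ∫ x, h x ∂μ := by
    conv_lhs => rw [h1]
    rw [← integral_const_mul]
    refine integral_mono ?_ (integrable_of_continuous_compact (by fun_prop)) h2
    exact integrable_of_continuous_compact
      (continuous_integral_left (f := fun x y => g y * f x y ^ 2)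
        ((hg.comp continuous_snd).mul hf2))
  rcases hG.eq_or_lt with h0 | h0
  · rw [← h0]; positivity
  · have h4 := pow_le_pow_left₀ hG h3 2
    rw [mul_pow, Real.sq_sqrt (by positivity), pow_two, mul_assoc] at h4
    exact le_of_mul_le_mul_left h4 h0

/-- Moment comparison tensorises as in hypercontractivity: one factor K comes from the inner
integral over x, the other from `integral_sq_integral_le`. -/
theorem prod_fourth_moment_le {f : X → Y → ℝ} (hf : Continuous f.uncurry) {K : ℝ} (hK : 0 ≤ K)
    (hx : ∀ x, ∫ y, f x y ^ 4 ∂ν ≤ K * (∫ y, f x y ^ 2 ∂ν) ^ 2)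
    (hy : ∀ y, ∫ x, f x y ^ 4 ∂μ ≤ K * (∫ x, f x y ^ 2 ∂μ) ^ 2) :
    ∫ p, f p.1 p.2 ^ 4 ∂(μ.prod ν) ≤ K ^ 2 * (∫ p, f p.1 p.2 ^ 2 ∂(μ.prod ν)) ^ 2 := by
  have hi : ∀ n : ℕ, Integrable (fun p : X × Y => f p.1 p.2 ^ n) (μ.prod ν) := fun n =>
    integrable_of_continuous_compact (hf.pow n)
  rw [integral_prod_symm _ (hi 4), integral_prod _ (hi 2)]
  have hc : ∀ n : ℕ, Continuous fun y => ∫ x, f x y ^ n ∂μ := fun n =>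
    continuous_integral_left (f := fun y x => f x y ^ n) ((hf.pow n).comp continuous_swap)
  calc ∫ y, ∫ x, f x y ^ 4 ∂μ ∂ν ≤ ∫ y, K * (∫ x, f x y ^ 2 ∂μ) ^ 2 ∂ν :=
        integral_mono (integrable_of_continuous_compact (hc 4))
          (integrable_of_continuous_compact (((hc 2).pow 2).const_mul K)) hy
    _ = K * ∫ y, (∫ x, f x y ^ 2 ∂μ) ^ 2 ∂ν := integral_const_mul _ _
    _ ≤ K * (K * (∫ x, ∫ y, f x y ^ 2 ∂ν ∂μ) ^ 2) :=
        mul_le_mul_of_nonneg_left (integral_sq_integral_le hf hK hx) hK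
    _ = _ := by ring

/-- A lower bound on the first moment from the second and the fourth one. -/
theorem sqrt_second_moment_le {q : X → ℝ} (hq : Continuous q) {K : ℝ} (hK : 0 < K)
    (h4 : ∫ x, q x ^ 4 ∂μ ≤ K ^ 2 * (∫ x, q x ^ 2 ∂μ) ^ 2) :
    Real.sqrt (∫ x, q x ^ 2 ∂μ) ≤ K * ∫ x, |q x| ∂μ := by
  set m := ∫ x, q x ^ 2 ∂μ
  have hm : 0 ≤ m := integral_nonneg fun _ => sq_nonneg _
  -- This s makes the fourth moment at most s²m. Integrating the pointwise inequality below then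
  -- yields m ≤ s E|q|, the bound that Hölder's inequality would give.
  set s := K * Real.sqrt m
  have hs2 : s ^ 2 = K ^ 2 * m := by rw [mul_pow, Real.sq_sqrt hm]
  have hs0 : 0 ≤ s := by positivity
  -- The difference of the two sides is |q|(|q| − s)²(|q| + 2s), with equality at |q| = s.
  have hpt : ∀ x, 3 * s ^ 2 * q x ^ 2 ≤ 2 * s ^ 3 * |q x| + q x ^ 4 := fun x => by
    have h1 : q x ^ 2 = |q x| ^ 2 := (sq_abs _).symm
    have h2 : q x ^ 4 = |q x| ^ 4 := by rw [pow_abs, abs_of_nonneg]; positivity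
    rw [h1, h2]
    have : 0 ≤ |q x| * (|q x| - s) ^ 2 * (|q x| + 2 * s) := by positivity
    nlinarith
  have hint : 3 * s ^ 2 * m ≤ 2 * s ^ 3 * ∫ x, |q x| ∂μ + ∫ x, q x ^ 4 ∂μ := by
    rw [← integral_const_mul, ← integral_const_mul, ← integral_add]
    · exact integral_mono (integrable_of_continuous_compact (by fun_prop))
        (integrable_of_continuous_compact (by fun_prop)) hpt
    all_goals exact integrable_of_continuous_compact (by fun_prop)
  have hi : 0 ≤ ∫ x, |q x| ∂μ := integral_nonneg fun _ => abs_nonneg _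
  rcases hm.eq_or_lt with h0 | h0
  · rw [← h0, Real.sqrt_zero]; positivity
  · have hs : 0 < s ^ 2 := by rw [hs2]; positivity
    have h5 : s ^ 2 * m ≤ s ^ 2 * (s * ∫ x, |q x| ∂μ) := by
      have : K ^ 2 * m ^ 2 = s ^ 2 * m := by rw [hs2]; ring
      nlinarith
    have h6 := le_of_mul_le_mul_left h5 hs
    have h7 : Real.sqrt m * Real.sqrt m ≤ Real.sqrt m * (K * ∫ x, |q x| ∂μ) := by
      rw [Real.mul_self_sqrt hm]
      calc m ≤ s * ∫ x, |q x| ∂μ := h6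
        _ = _ := by ring
    exact le_of_mul_le_mul_left h7 (Real.sqrt_pos.2 h0)

end Moments

/-! ### Contractions of bipartite operators -/

section Contract

variable {ι κ : Type} [Fintype ι] [Fintype κ]

/-- The product vector `x ⊗ y`. -/
def prodVec (x : ι → ℂ) (y : κ → ℂ) : ι × κ → ℂ := fun p => x p.1 * y p.2

/-- The block `(⟨i| ⊗ 1) ξ (|j⟩ ⊗ 1)`. -/
def blockA {ι κ : Type} (ξ : Op (ι × κ)) (i j : ι) : Op κ := Matrix.of fun k l => ξ (i, k) (j, l)

/-- The partial contraction `(1 ⊗ ⟨y|) ξ (1 ⊗ |y⟩)`. -/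
def contractB (ξ : Op (ι × κ)) (y : κ → ℂ) : Op ι :=
  Matrix.of fun i j => star y ⬝ᵥ blockA ξ i j *ᵥ y

/-- The partial contraction `(⟨x| ⊗ 1) ξ (|x⟩ ⊗ 1)`. -/
def contractA (ξ : Op (ι × κ)) (x : ι → ℂ) : Op κ :=
  Matrix.of fun k l => star x ⬝ᵥ (Matrix.of fun i j => ξ (i, k) (j, l)) *ᵥ x

theorem dotProduct_prodVec (ξ : Op (ι × κ)) (x : ι → ℂ) (y : κ → ℂ) :
    star (prodVec x y) ⬝ᵥ ξ *ᵥ prodVec x y =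
      ∑ i, ∑ j, ∑ k, ∑ l, star (x i) * star (y k) * ξ (i, k) (j, l) * x j * y l := by
  simp only [dotProduct, Matrix.mulVec, Fintype.sum_prod_type, prodVec, Pi.star_apply, star_mul,
    Finset.mul_sum]
  refine Finset.sum_congr rfl fun i _ => ?_
  rw [Finset.sum_comm]
  refine Finset.sum_congr rfl fun j _ => Finset.sum_congr rfl fun k _ =>
    Finset.sum_congr rfl fun l _ => ?_
  ring

theorem quadForm_contractB (ξ : Op (ι × κ)) (x : ι → ℂ) (y : κ → ℂ) :
    quadForm (contractB ξ y) x = quadForm ξ (prodVec x y) := by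
  rw [quadForm, quadForm, dotProduct_prodVec]
  congr 1
  simp only [contractB, blockA, dotProduct, Matrix.mulVec, Pi.star_apply, Finset.mul_sum,
    Finset.sum_mul, Matrix.of_apply]
  refine Finset.sum_congr rfl fun i _ => Finset.sum_congr rfl fun j _ =>
    Finset.sum_congr rfl fun k _ => Finset.sum_congr rfl fun l _ => ?_
  ring

theorem quadForm_contractA (ξ : Op (ι × κ)) (x : ι → ℂ) (y : κ → ℂ) :
    quadForm (contractA ξ x) y = quadForm ξ (prodVec x y) := by
  rw [quadForm, quadForm, dotProduct_prodVec]
  congr 1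
  simp only [contractA, dotProduct, Matrix.mulVec, Pi.star_apply, Finset.mul_sum,
    Finset.sum_mul, Matrix.of_apply]
  rw [Finset.sum_congr rfl fun k _ => Finset.sum_comm, Finset.sum_comm]
  refine Finset.sum_congr rfl fun i _ => ?_
  rw [Finset.sum_congr rfl fun k _ => Finset.sum_comm, Finset.sum_comm]
  refine Finset.sum_congr rfl fun j _ =>
    Finset.sum_congr rfl fun k _ => Finset.sum_congr rfl fun l _ => ?_
  ring

end Contract

theorem star_dotProduct_mulVec {ι : Type} [Fintype ι] (C : Op ι) (x : ι → ℂ) :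
    star (star x ⬝ᵥ C *ᵥ x) = star x ⬝ᵥ Cᴴ *ᵥ x := by
  rw [← Matrix.star_dotProduct_star, star_star, Matrix.star_mulVec, ← Matrix.dotProduct_mulVec]

theorem isHermitian_contractB {ι κ : Type} [Fintype κ] {ξ : Op (ι × κ)} (hξ : ξ.IsHermitian)
    (y : κ → ℂ) :
    (contractB ξ y).IsHermitian := by
  ext i j
  simp only [contractB, Matrix.conjTranspose_apply, Matrix.of_apply, star_dotProduct_mulVec]
  congr 2
  ext k l
  exact hξ.apply _ _

theorem isHermitian_contractA {ι κ : Type} [Fintype ι] {ξ : Op (ι × κ)} (hξ : ξ.IsHermitian)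
    (x : ι → ℂ) :
    (contractA ξ x).IsHermitian := by
  ext i j
  simp only [contractA, Matrix.conjTranspose_apply, Matrix.of_apply, star_dotProduct_mulVec]
  congr 2
  ext k l
  exact hξ.apply _ _

/-! ### The lower bound for the tensor product of isotropic POVMs -/

/-- The Hermitian part of an operator. -/
def hermPart {ι : Type} (C : Op ι) : Op ι := (1 / 2 : ℂ) • (C + Cᴴ)

theorem isHermitian_hermPart {ι : Type} (C : Op ι) : (hermPart C).IsHermitian := by
  ext i j
  simp [hermPart, add_comm, mul_add]

theorem quadForm_hermPart {ι : Type} [Fintype ι] (C : Op ι) (x : ι → ℂ) :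
    quadForm (hermPart C) x = quadForm C x := by
  simp only [quadForm, hermPart, Matrix.smul_mulVec, dotProduct_smul, Matrix.add_mulVec,
    dotProduct_add, ← star_dotProduct_mulVec, smul_eq_mul]
  simp
  ring

/-- Writing C = H₁ + iH₂ with Hermitian H₁ and H₂, the two summands are orthogonal for the real
Hilbert–Schmidt inner product. -/
theorem frobSq_hermPart_add {ι : Type} [Fintype ι] (C : Op ι) :
    frobSq (hermPart C) + frobSq (hermPart (-Complex.I • C)) = frobSq C := by
  have h : ∀ i j, ‖hermPart C i j‖ ^ 2 + ‖hermPart (-Complex.I • C) i j‖ ^ 2 =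
      1 / 2 * ‖C i j‖ ^ 2 + 1 / 2 * ‖C j i‖ ^ 2 := fun i j => by
    simp only [hermPart, Matrix.smul_apply, Matrix.add_apply, Matrix.conjTranspose_apply,
      smul_eq_mul, Complex.sq_norm, Complex.normSq_apply, Complex.mul_re, Complex.mul_im,
      Complex.add_re, Complex.add_im, Complex.star_def, Complex.conj_re, Complex.conj_im,
      Complex.neg_re, Complex.neg_im, Complex.I_re, Complex.I_im]
    norm_num
    ring
  simp only [frobSq, ← Finset.sum_add_distrib, h]
  simp only [Finset.sum_add_distrib, ← Finset.mul_sum]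
  rw [Finset.sum_comm (f := fun i j => ‖C j i‖ ^ 2)]
  ring

theorem frobSq_eq_sum_blockA {ι κ : Type} [Fintype ι] [Fintype κ] (ξ : Op (ι × κ)) :
    frobSq ξ = ∑ i, ∑ j, frobSq (blockA ξ i j) := by
  simp only [frobSq, Fintype.sum_prod_type, blockA, Matrix.of_apply]
  exact Finset.sum_congr rfl fun i _ => Finset.sum_comm

section UU

variable {d : ℕ}

theorem continuous_unitVec : Continuous fun ψ : UnitVec d => ψ.1.ofLp :=
  (PiLp.continuous_ofLp 2 _).comp continuous_subtype_val

/-- The exact second moment is applied to both Hermitian parts and the squared traces are dropped.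
Hermiticity is not available here, because the lemma is used for the off-diagonal blocks of ξ. -/
theorem frobSq_le_sphere_moment [NeZero d] (C : Op (Fin d)) :
    frobSq C ≤ (∫ ψ : UnitVec d, ‖star ψ.1.ofLp ⬝ᵥ C *ᵥ ψ.1.ofLp‖ ^ 2 ∂uniformUnit d) *
      (d * (d + 1)) := by
  have h : ∀ ψ : UnitVec d, ‖star ψ.1.ofLp ⬝ᵥ C *ᵥ ψ.1.ofLp‖ ^ 2 =
      quadForm (hermPart C) ψ.1.ofLp ^ 2 + quadForm (hermPart (-Complex.I • C)) ψ.1.ofLp ^ 2 :=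
    fun ψ => by
      rw [quadForm_hermPart, quadForm_hermPart, quadForm, quadForm, Matrix.smul_mulVec,
        dotProduct_smul, Complex.sq_norm, Complex.normSq_apply]
      simp
      ring
  have hc : ∀ H : Op (Fin d), Integrable (fun ψ : UnitVec d => quadForm H ψ.1.ofLp ^ 2)
      (uniformUnit d) := fun H => integrable_of_continuous_compact
    (((continuous_quadForm H).comp continuous_unitVec).pow 2)
  simp only [h]
  rw [integral_add (hc _) (hc _), add_mul, sphere_second_moment (isHermitian_hermPart _),
    sphere_second_moment (isHermitian_hermPart _), ← frobSq_hermPart_add C]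
  nlinarith [sq_nonneg (∑ i, (isHermitian_hermPart C).eigenvalues i),
    sq_nonneg (∑ i, (isHermitian_hermPart (-Complex.I • C)).eigenvalues i)]

theorem continuous_prodForm (ξ : Op (Bi d d)) :
    Continuous fun p : UnitVec d × UnitVec d =>
      quadForm ξ (prodVec p.1.1.ofLp p.2.1.ofLp) := by
  refine (continuous_quadForm ξ).comp (continuous_pi fun q => ?_)
  exact ((continuous_apply q.1).comp (continuous_unitVec.comp continuous_fst)).mul
    ((continuous_apply q.2).comp (continuous_unitVec.comp continuous_snd))

/-- The one-party bound is used twice: over ψ for the contraction of ξ with φ, then over φ for each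
entry of that contraction, which is the quadratic form of a block of ξ. -/
theorem frobSq_le_prod_moment [NeZero d] {ξ : Op (Bi d d)} (hξ : ξ.IsHermitian) :
    frobSq ξ ≤ (∫ p : UnitVec d × UnitVec d, quadForm ξ (prodVec p.1.1.ofLp p.2.1.ofLp) ^ 2
      ∂(uniformUnit d).prod (uniformUnit d)) * (d * (d + 1)) ^ 2 := by
  rw [integral_prod_symm (fun p : UnitVec d × UnitVec d =>
    quadForm ξ (prodVec p.1.1.ofLp p.2.1.ofLp) ^ 2)
    (integrable_of_continuous_compact ((continuous_prodForm ξ).pow 2))]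
  have hcont : Continuous fun φ : UnitVec d =>
      ∫ ψ : UnitVec d, quadForm ξ (prodVec ψ.1.ofLp φ.1.ofLp) ^ 2 ∂uniformUnit d :=
    continuous_integral_left (f := fun φ ψ : UnitVec d =>
      quadForm ξ (prodVec ψ.1.ofLp φ.1.ofLp) ^ 2)
      (((continuous_prodForm ξ).comp continuous_swap).pow 2)
  have hblock : ∀ i j, Continuous fun φ : UnitVec d =>
      ‖star φ.1.ofLp ⬝ᵥ blockA ξ i j *ᵥ φ.1.ofLp‖ ^ 2 := fun i j => by
    have := continuous_unitVec (d := d)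
    fun_prop
  have h1 : ∀ φ : UnitVec d, frobSq (contractB ξ φ.1.ofLp) ≤
      (∫ ψ : UnitVec d, quadForm ξ (prodVec ψ.1.ofLp φ.1.ofLp) ^ 2 ∂uniformUnit d) *
        (d * (d + 1)) := fun φ => by
    simp only [← quadForm_contractB]
    rw [sphere_second_moment (isHermitian_contractB hξ _)]
    linarith [sq_nonneg (∑ i, (isHermitian_contractB hξ φ.1.ofLp).eigenvalues i)]
  have h2 : (∫ φ : UnitVec d, frobSq (contractB ξ φ.1.ofLp) ∂uniformUnit d) ≤
      (∫ φ : UnitVec d, ∫ ψ : UnitVec d, quadForm ξ (prodVec ψ.1.ofLp φ.1.ofLp) ^ 2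
        ∂uniformUnit d ∂uniformUnit d) * (d * (d + 1)) := by
    rw [← integral_mul_const]
    refine integral_mono (integrable_of_continuous_compact ?_)
      (integrable_of_continuous_compact (hcont.mul_const _)) h1
    simp only [frobSq, contractB, Matrix.of_apply]
    exact continuous_finsetSum _ fun i _ => continuous_finsetSum _ fun j _ => hblock i j
  have h3 : frobSq ξ ≤ (∫ φ : UnitVec d, frobSq (contractB ξ φ.1.ofLp) ∂uniformUnit d) *
      (d * (d + 1)) := by
    rw [frobSq_eq_sum_blockA]
    have hfr : ∀ φ : UnitVec d, frobSq (contractB ξ φ.1.ofLp) =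
        ∑ i, ∑ j, ‖star φ.1.ofLp ⬝ᵥ blockA ξ i j *ᵥ φ.1.ofLp‖ ^ 2 := fun _ => rfl
    simp only [hfr]
    rw [integral_finsetSum _ fun i _ => integrable_of_continuous_compact
      (continuous_finsetSum _ fun j _ => hblock i j), Finset.sum_mul]
    refine Finset.sum_le_sum fun i _ => ?_
    rw [integral_finsetSum _ fun j _ => integrable_of_continuous_compact (hblock i j),
      Finset.sum_mul]
    exact Finset.sum_le_sum fun j _ => frobSq_le_sphere_moment _
  have hd : (0 : ℝ) ≤ d * (d + 1) := by positivity
  refine (h3.trans (mul_le_mul_of_nonneg_right h2 hd)).trans (le_of_eq ?_)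
  ring

theorem trace_mul_isotropic (ξ : Op (Bi d d)) (ψ φ : UnitVec d) :
    (ξ * (isotropic d ψ ⊗ₖ isotropic d φ)).trace =
      (d : ℂ) ^ 2 * (star (prodVec ψ.1.ofLp φ.1.ofLp) ⬝ᵥ ξ *ᵥ prodVec ψ.1.ofLp φ.1.ofLp) := by
  have h : isotropic d ψ ⊗ₖ isotropic d φ = (d : ℂ) ^ 2 •
      Matrix.vecMulVec (prodVec ψ.1.ofLp φ.1.ofLp) (star (prodVec ψ.1.ofLp φ.1.ofLp)) := by
    ext p q
    simp [isotropic, prodVec, Matrix.vecMulVec_apply]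
    ring
  rw [h, Matrix.mul_smul, Matrix.trace_smul, Matrix.mul_vecMulVec, Matrix.trace_vecMulVec,
    dotProduct_comm, smul_eq_mul]

theorem sqrt_frobSq_le_continuousOutcomeNorm [NeZero d] {ξ : Op (Bi d d)} (hξ : ξ.IsHermitian) :
    Real.sqrt (frobSq ξ) / 12 ≤ continuousOutcomeNorm ((uniformUnit d).prod (uniformUnit d))
      (fun ω : UnitVec d × UnitVec d => isotropic d ω.1 ⊗ₖ isotropic d ω.2) ξ := by
  have hd : (0 : ℝ) < d := by exact_mod_cast Nat.pos_of_ne_zero (NeZero.ne d)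
  set K : ℝ := 12 * (d * (d + 1)) / ((d + 2) * (d + 3)) with hK
  have hK0 : 0 < K := by positivity
  have hcont := continuous_prodForm ξ
  have h4 := prod_fourth_moment_le (μ := uniformUnit d) (ν := uniformUnit d)
    (f := fun ψ φ : UnitVec d => quadForm ξ (prodVec ψ.1.ofLp φ.1.ofLp)) hcont hK0.le
    (fun ψ => by
      simp only [← quadForm_contractA]
      exact sphere_fourth_le_second_sq (isHermitian_contractA hξ _))
    (fun φ => by
      simp only [← quadForm_contractB]
      exact sphere_fourth_le_second_sq (isHermitian_contractB hξ _))
  have h1 := sqrt_second_moment_le hcont hK0 h4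
  have h2 := frobSq_le_prod_moment hξ
  set m := ∫ p : UnitVec d × UnitVec d, quadForm ξ (prodVec p.1.1.ofLp p.2.1.ofLp) ^ 2
      ∂(uniformUnit d).prod (uniformUnit d)
  set N := ∫ p : UnitVec d × UnitVec d, |quadForm ξ (prodVec p.1.1.ofLp p.2.1.ofLp)|
      ∂(uniformUnit d).prod (uniformUnit d)
  have hN : 0 ≤ N := integral_nonneg fun _ => abs_nonneg _
  have h3 : Real.sqrt (frobSq ξ) ≤ Real.sqrt m * (d * (d + 1)) := by
    refine (Real.sqrt_le_sqrt h2).trans (le_of_eq ?_)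
    rw [Real.sqrt_mul' _ (by positivity), Real.sqrt_sq (by positivity)]
  have h5 : (d : ℝ) ^ 2 * N ≤ continuousOutcomeNorm ((uniformUnit d).prod (uniformUnit d))
      (fun ω : UnitVec d × UnitVec d => isotropic d ω.1 ⊗ₖ isotropic d ω.2) ξ := by
    rw [continuousOutcomeNorm, ← integral_const_mul]
    refine integral_mono (integrable_of_continuous_compact (by fun_prop))
      (integrable_of_continuous_compact ?_) fun p => ?_
    · simp only [trace_mul_isotropic]
      refine (continuous_const.mul ?_).norm
      have hv : Continuous fun p : UnitVec d × UnitVec d => prodVec p.1.1.ofLp p.2.1.ofLp :=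
        continuous_pi fun q =>
          ((continuous_apply q.1).comp (continuous_unitVec.comp continuous_fst)).mul
            ((continuous_apply q.2).comp (continuous_unitVec.comp continuous_snd))
      fun_prop
    · simp only [trace_mul_isotropic, norm_mul, norm_pow, Complex.norm_natCast]
      exact mul_le_mul_of_nonneg_left (Complex.abs_re_le_norm _) (by positivity)
  refine le_trans ?_ h5
  have h6 : Real.sqrt (frobSq ξ) ≤ K * N * (d * (d + 1)) :=
    h3.trans (mul_le_mul_of_nonneg_right h1 (by positivity))
  -- This amounts to (d+1)² ≤ (d+2)(d+3). The factor d² then cancels against the density of the two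
  -- isotropic POVMs.
  have h7 : K * (d * (d + 1)) ≤ 12 * (d : ℝ) ^ 2 := by
    rw [hK, div_mul_eq_mul_div, div_le_iff₀ (by positivity)]
    nlinarith [mul_pos hd hd, mul_pos (mul_pos hd hd) hd]
  have h8 := mul_le_mul_of_nonneg_right h7 hN
  linarith

end UU

/-! ### Trace norm -/

section TraceNorm

variable {ι : Type} [Fintype ι] [DecidableEq ι]

/-- Cauchy–Schwarz for the vector of singular values, whose squares sum to tr X†X. -/
theorem traceNorm_le_sqrt_card_mul (X : Op ι) :
    traceNorm X ≤ Real.sqrt (Fintype.card ι) * Real.sqrt (frobSq X) := by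
  rw [← Real.sqrt_mul (Nat.cast_nonneg _)]
  apply Real.le_sqrt_of_sq_le
  have h := sq_sum_le_card_mul_sum_sq (s := Finset.univ)
    (f := fun i => Real.sqrt ((Matrix.isHermitian_conjTranspose_mul_self X).eigenvalues i))
  refine h.trans (le_of_eq ?_)
  have h1 := (Matrix.isHermitian_conjTranspose_mul_self X).trace_eq_sum_eigenvalues
  rw [trace_conjTranspose_mul_self] at h1
  have h2 : frobSq X = ∑ i, (Matrix.isHermitian_conjTranspose_mul_self X).eigenvalues i := by
    simpa using congrArg Complex.re h1
  rw [h2]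
  congr 1
  refine Finset.sum_congr rfl fun i _ => Real.sq_sqrt ?_
  exact (Matrix.posSemidef_conjTranspose_mul_self X).eigenvalues_nonneg i

/-- The eigenvalues of X†X are the squares of those of P. They are matched as multisets of roots of
the characteristic polynomial, so no ordering of the eigenvalues enters. -/
theorem traceNorm_eq_of_sq_eq {X P : Op ι} (hP : P.PosSemidef) (h : P * P = Xᴴ * X) :
    (traceNorm X : ℂ) = P.trace := by
  have hX := Matrix.isHermitian_conjTranspose_mul_self X
  have h1 := hX.roots_charpoly_eq_eigenvalues
  have hu : (hP.1.eigenvectorUnitary : Op ι)ᴴ * (hP.1.eigenvectorUnitary : Op ι) = 1 :=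
    (Matrix.mem_unitaryGroup_iff'.1 hP.1.eigenvectorUnitary.2)
  have h2 : (Xᴴ * X).charpoly.roots =
      Multiset.map (fun i => ((hP.1.eigenvalues i ^ 2 : ℝ) : ℂ)) Finset.univ.val := by
    rw [← h, hermitian_mul_self hP.1, Matrix.charpoly_mul_comm, ← Matrix.mul_assoc, hu,
      Matrix.one_mul, Matrix.charpoly_diagonal, Polynomial.roots_prod _ _
        (Finset.prod_ne_zero_iff.2 fun i _ => Polynomial.X_sub_C_ne_zero _)]
    simp only [Polynomial.roots_X_sub_C, Multiset.bind_singleton]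
  rw [h2] at h1
  have h3 := congrArg (fun s : Multiset ℂ => (s.map fun z => Real.sqrt z.re).sum) h1
  simp only [Multiset.map_map, Function.comp_def] at h3
  have h4 : traceNorm X = ∑ i, hP.1.eigenvalues i := by
    rw [traceNorm]
    refine Eq.trans (by exact h3.symm) ?_
    refine Finset.sum_congr rfl fun i _ => ?_
    simp only [Complex.ofReal_re]
    exact Real.sqrt_sq (hP.eigenvalues_nonneg i)
  rw [h4, hP.1.trace_eq_sum_eigenvalues]
  push_cast
  rfl

/-- Orthogonality gives (ρ − σ)² = (ρ + σ)², so ρ + σ is the absolute value of ρ − σ, and its trace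
is 2. -/
theorem traceNorm_sub_of_orthogonal {ρ σ : Op ι} (hρ : IsState ρ) (hσ : IsState σ)
    (h : ρ * σ = 0) : traceNorm (ρ - σ) = 2 := by
  have h' : σ * ρ = 0 := by
    have := congrArg Matrix.conjTranspose h
    rwa [Matrix.conjTranspose_mul, hρ.1.1.eq, hσ.1.1.eq, Matrix.conjTranspose_zero] at this
  have := traceNorm_eq_of_sq_eq (X := ρ - σ) (hρ.1.add hσ.1) (by
    rw [Matrix.conjTranspose_sub, hρ.1.1.eq, hσ.1.1.eq]
    simp only [add_mul, mul_add, sub_mul, mul_sub, h, h']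
    simp)
  rw [Matrix.trace_add, hρ.2, hσ.2] at this
  have h2 : ((2 : ℝ) : ℂ) = 1 + 1 := by norm_num
  rw [← h2] at this
  exact_mod_cast this

end TraceNorm

/-! ### Constants of domination -/

section Domination

variable {ι : Type} [Fintype ι] [DecidableEq ι] {N N' : Op ι → ℝ} {ξ₀ : Op ι}

/-- A real supremum over an unbounded set is 0 by convention, so a traceless Hermitian ξ₀ with
positive trace norm must be supplied. Later it is always `hidingDiff d`. -/
theorem bddAbove_lowerDomination (h1 : ξ₀.IsHermitian) (h2 : ξ₀.trace = 0)
    (h3 : 0 < traceNorm ξ₀) :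
    BddAbove {c : ℝ | ∀ ξ : Op ι, ξ.IsHermitian → ξ.trace = 0 → c * traceNorm ξ ≤ N ξ} :=
  ⟨N ξ₀ / traceNorm ξ₀, fun _ hc => (le_div_iff₀ h3).2 (hc ξ₀ h1 h2)⟩

theorem le_lowerDomination (h1 : ξ₀.IsHermitian) (h2 : ξ₀.trace = 0) (h3 : 0 < traceNorm ξ₀)
    {c : ℝ} (hc : ∀ ξ : Op ι, ξ.IsHermitian → ξ.trace = 0 → c * traceNorm ξ ≤ N ξ) :
    c ≤ lowerDomination N :=
  le_csSup (bddAbove_lowerDomination h1 h2 h3) hc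

theorem lowerDomination_le (h1 : ξ₀.IsHermitian) (h2 : ξ₀.trace = 0) (h3 : 0 < traceNorm ξ₀)
    (hN : ∀ ξ, 0 ≤ N ξ) {C : ℝ} (hC : N ξ₀ ≤ C * traceNorm ξ₀) : lowerDomination N ≤ C :=
  csSup_le ⟨0, fun ξ _ _ => by simpa using hN ξ⟩ fun _ hc =>
    le_of_mul_le_mul_right ((hc ξ₀ h1 h2).trans hC) h3

theorem lowerDomination_mono (h1 : ξ₀.IsHermitian) (h2 : ξ₀.trace = 0) (h3 : 0 < traceNorm ξ₀)
    (hN : ∀ ξ, 0 ≤ N ξ) (h : ∀ ξ : Op ι, ξ.IsHermitian → ξ.trace = 0 → N ξ ≤ N' ξ) :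
    lowerDomination N ≤ lowerDomination N' :=
  csSup_le_csSup (bddAbove_lowerDomination h1 h2 h3) ⟨0, fun ξ _ _ => by simpa using hN ξ⟩
    fun _ hc ξ hξ hξ' => (hc ξ hξ hξ').trans (h ξ hξ hξ')

end Domination

/-! ### The convex body of a set of POVMs -/

section Body

variable {ι : Type} [Fintype ι] [DecidableEq ι]

theorem bodyNorm_nonneg {ι : Type} [Fintype ι] (K : Set (Op ι)) (ξ : Op ι) : 0 ≤ bodyNorm K ξ :=
  Real.sSup_nonneg fun r hr => by obtain ⟨X, -, rfl⟩ := hr; positivity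

theorem outcomeNorm_nonneg {ι : Type} [Fintype ι] {n : ℕ} (M : Fin n → Op ι) (ξ : Op ι) :
    0 ≤ outcomeNorm M ξ :=
  Finset.sum_nonneg fun _ _ => norm_nonneg _

theorem povmSetNorm_nonneg {ι : Type} [Fintype ι] (C : POVMSet ι) (ξ : Op ι) :
    0 ≤ povmSetNorm C ξ :=
  Real.sSup_nonneg fun r hr => by obtain ⟨n, M, -, rfl⟩ := hr; exact outcomeNorm_nonneg M ξ

theorem trace_mul_im_eq_zero {ι : Type} [Fintype ι] {A B : Op ι} (hA : A.IsHermitian)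
    (hB : B.IsHermitian) :
    (A * B).trace.im = 0 := by
  have h : star (A * B).trace = (A * B).trace := by
    rw [← Matrix.trace_conjTranspose, Matrix.conjTranspose_mul, hA.eq, hB.eq, Matrix.trace_mul_comm]
  exact Complex.conj_eq_iff_im.1 h

theorem norm_trace_mul_eq_abs {ι : Type} [Fintype ι] {A B : Op ι} (hA : A.IsHermitian)
    (hB : B.IsHermitian) :
    ‖(A * B).trace‖ = |(A * B).trace.re| := by
  rw [← Real.norm_eq_abs, ← Complex.norm_real]
  congr 1
  exact Complex.ext rfl (by simpa using trace_mul_im_eq_zero hA hB)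

/-- In an eigenbasis of ξ the diagonals of the Mₖ are nonnegative and sum to 1. The bound serves
only to make the suprema over POVMs and over bodies finite. -/
theorem outcomeNorm_le {n : ℕ} {M : Fin n → Op ι} (hM : IsPOVM M) {ξ : Op ι}
    (hξ : ξ.IsHermitian) : outcomeNorm M ξ ≤ ∑ i, |hξ.eigenvalues i| := by
  set U : Op ι := (hξ.eigenvectorUnitary : Op ι)
  have hu : Uᴴ * U = 1 := (Matrix.mem_unitaryGroup_iff'.1 hξ.eigenvectorUnitary.2)
  have hpsd : ∀ k, (Uᴴ * M k * U).PosSemidef := fun k => (hM.1 k).conjTranspose_mul_mul_same U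
  have h1 : ∀ k, ‖(ξ * M k).trace‖ ≤ ∑ i, |hξ.eigenvalues i| * ((Uᴴ * M k * U) i i).re :=
    fun k => by
      have : (ξ * M k).trace = ∑ i, (hξ.eigenvalues i : ℂ) * (Uᴴ * M k * U) i i := by
        conv_lhs => rw [hermitian_eq_conj_diagonal hξ]
        rw [Matrix.conjTranspose_conjTranspose, Matrix.mul_assoc, Matrix.mul_assoc,
          Matrix.trace_mul_comm, Matrix.mul_assoc, Matrix.trace]
        simp [U]
      rw [this]
      refine (norm_sum_le _ _).trans (Finset.sum_le_sum fun i _ => ?_)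
      rw [norm_mul, Complex.norm_real, Real.norm_eq_abs]
      have h0 := Complex.le_def.1 ((hpsd k).diag_nonneg (i := i))
      have h0' : ‖(Uᴴ * M k * U) i i‖ = ((Uᴴ * M k * U) i i).re := by
        rw [← Complex.re_eq_norm.2 ((hpsd k).diag_nonneg (i := i))]
      rw [h0']
  refine (Finset.sum_le_sum fun k _ => h1 k).trans (le_of_eq ?_)
  rw [Finset.sum_comm]
  refine Finset.sum_congr rfl fun i _ => ?_
  rw [← Finset.mul_sum, ← Complex.re_sum, ← Matrix.sum_apply, ← Matrix.sum_mul, ← Matrix.mul_sum,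
    hM.2, Matrix.mul_one, hu, Matrix.one_apply_eq, Complex.one_re, mul_one]

theorem sum_trace_re {n : ℕ} {M : Fin n → Op ι} (hM : IsPOVM M) (ξ : Op ι) :
    ∑ k, (ξ * M k).trace.re = ξ.trace.re := by
  rw [← Complex.re_sum, ← Matrix.trace_sum, ← Matrix.mul_sum, hM.2, Matrix.mul_one]

theorem trace_mul_generator {n : ℕ} {M : Fin n → Op ι} {ξ : Op ι} (hξ : ξ.trace = 0)
    (I : Finset (Fin n)) :
    (ξ * ((2 : ℂ) • (∑ k ∈ I, M k) - 1)).trace = 2 * ∑ k ∈ I, (ξ * M k).trace := by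
  rw [Matrix.mul_sub, Matrix.trace_sub, Matrix.mul_one, hξ, sub_zero, Matrix.mul_smul,
    Matrix.trace_smul, Matrix.mul_sum, Matrix.trace_sum, smul_eq_mul]

/-- As ξ is traceless, the sums of tr(ξMₖ) over I and over its complement are opposite, so twice one
of them in modulus is the sum of both moduli. -/
theorem norm_trace_mul_generator_le {n : ℕ} {M : Fin n → Op ι} (hM : IsPOVM M) {ξ : Op ι}
    (hξ : ξ.IsHermitian) (hξ' : ξ.trace = 0) (I : Finset (Fin n)) :
    ‖(ξ * ((2 : ℂ) • (∑ k ∈ I, M k) - 1)).trace‖ ≤ outcomeNorm M ξ := by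
  have h := sum_trace_re hM ξ
  rw [hξ', Complex.zero_re, ← Finset.sum_add_sum_compl I] at h
  have h0 : (∑ k ∈ I, (ξ * M k).trace) = ((∑ k ∈ I, (ξ * M k).trace.re : ℝ) : ℂ) := by
    push_cast
    refine Finset.sum_congr rfl fun k _ => Complex.ext rfl ?_
    simpa using trace_mul_im_eq_zero hξ (hM.1 k).1
  rw [trace_mul_generator hξ', h0, outcomeNorm]
  simp only [fun k => norm_trace_mul_eq_abs hξ (hM.1 k).1]
  rw [← Finset.sum_add_sum_compl I, norm_mul, Complex.norm_real, Real.norm_eq_abs,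
    Complex.norm_ofNat]
  have h1 := Finset.abs_sum_le_sum_abs (fun k => (ξ * M k).trace.re) I
  have h2 := Finset.abs_sum_le_sum_abs (fun k => (ξ * M k).trace.re) Iᶜ
  have h3 : |∑ k ∈ Iᶜ, (ξ * M k).trace.re| = |∑ k ∈ I, (ξ * M k).trace.re| := by
    rw [eq_neg_of_add_eq_zero_right h, abs_neg]
  linarith

theorem exists_generator_eq_outcomeNorm {n : ℕ} {M : Fin n → Op ι} (hM : IsPOVM M) {ξ : Op ι}
    (hξ : ξ.IsHermitian) (hξ' : ξ.trace = 0) :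
    ∃ I : Finset (Fin n),
      outcomeNorm M ξ = (ξ * ((2 : ℂ) • (∑ k ∈ I, M k) - 1)).trace.re := by
  -- The best guess groups the outcomes by the sign of tr(ξMₖ).
  refine ⟨Finset.univ.filter fun k => 0 ≤ (ξ * M k).trace.re, ?_⟩
  have h := sum_trace_re hM ξ
  rw [hξ', Complex.zero_re] at h
  rw [trace_mul_generator hξ', outcomeNorm]
  simp only [fun k => norm_trace_mul_eq_abs hξ (hM.1 k).1]
  have h2 : (2 * ∑ k ∈ Finset.univ.filter (fun k => 0 ≤ (ξ * M k).trace.re),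
      (ξ * M k).trace).re = 2 * ∑ k, if 0 ≤ (ξ * M k).trace.re then (ξ * M k).trace.re else 0 := by
    rw [Complex.mul_re, Complex.re_sum, Finset.sum_filter]
    simp
  rw [h2]
  have h3 : ∑ k, |(ξ * M k).trace.re| = ∑ k, (2 * (if 0 ≤ (ξ * M k).trace.re then
      (ξ * M k).trace.re else 0) - (ξ * M k).trace.re) := by
    refine Finset.sum_congr rfl fun k _ => ?_
    split_ifs with hk
    · rw [abs_of_nonneg hk]; ring
    · rw [abs_of_neg (not_le.1 hk)]; ring
  rw [h3, Finset.sum_sub_distrib, h, sub_zero, Finset.mul_sum]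

theorem generator_mem_body {ι : Type} [DecidableEq ι] {C : POVMSet ι} {n : ℕ} {M : Fin n → Op ι}
    (hM : M ∈ C n)
    (I : Finset (Fin n)) : (2 : ℂ) • (∑ k ∈ I, M k) - 1 ∈ body C :=
  subset_closure (subset_convexHull ℝ _ ⟨n, M, I, hM, rfl⟩)

/-- The operators obeying the bound form a closed convex set, so it suffices to check the
generators. -/
theorem norm_trace_mul_le_of_mem_body {C : POVMSet ι} {ξ : Op ι} {B : ℝ}
    (h : ∀ (n : ℕ) (M : Fin n → Op ι) (I : Finset (Fin n)), M ∈ C n →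
      ‖(ξ * ((2 : ℂ) • (∑ k ∈ I, M k) - 1)).trace‖ ≤ B) {X : Op ι} (hX : X ∈ body C) :
    ‖(ξ * X).trace‖ ≤ B := by
  have hsub : body C ⊆ {X : Op ι | ‖(ξ * X).trace‖ ≤ B} := by
    refine closure_minimal (convexHull_min ?_ ?_) ?_
    · rintro X ⟨n, M, I, hM, rfl⟩
      exact h n M I hM
    · intro X hX Y hY a b ha hb hab
      simp only [Set.mem_ofPred_eq] at hX hY ⊢
      rw [Matrix.mul_add, Matrix.mul_smul, Matrix.mul_smul, Matrix.trace_add, Matrix.trace_smul,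
        Matrix.trace_smul]
      refine (norm_add_le _ _).trans ?_
      rw [norm_smul, norm_smul, Real.norm_of_nonneg ha, Real.norm_of_nonneg hb]
      have := mul_le_mul_of_nonneg_left hX ha
      have := mul_le_mul_of_nonneg_left hY hb
      have hB : a * B + b * B = B := by rw [← add_mul, hab, one_mul]
      linarith
    · refine isClosed_le ?_ continuous_const
      exact (Continuous.matrix_trace (continuous_const.matrix_mul continuous_id)).norm
  exact hsub hX

theorem bodyNorm_le {C : POVMSet ι} {ξ : Op ι} {B : ℝ} (hB : 0 ≤ B)
    (h : ∀ (n : ℕ) (M : Fin n → Op ι) (I : Finset (Fin n)), M ∈ C n →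
      ‖(ξ * ((2 : ℂ) • (∑ k ∈ I, M k) - 1)).trace‖ ≤ B) : bodyNorm (body C) ξ ≤ B :=
  Real.sSup_le (fun r hr => by
    obtain ⟨X, hX, rfl⟩ := hr
    exact norm_trace_mul_le_of_mem_body h hX) hB

theorem le_bodyNorm {C : POVMSet ι} (hC : ∀ (n : ℕ) (M : Fin n → Op ι), M ∈ C n → IsPOVM M)
    {ξ : Op ι} (hξ : ξ.IsHermitian) (hξ' : ξ.trace = 0) {X : Op ι} (hX : X ∈ body C) :
    ‖(ξ * X).trace‖ ≤ bodyNorm (body C) ξ :=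
  le_csSup ⟨∑ i, |hξ.eigenvalues i|, fun r hr => by
    obtain ⟨Y, hY, rfl⟩ := hr
    exact norm_trace_mul_le_of_mem_body (fun n M I hM =>
      (norm_trace_mul_generator_le (hC n M hM) hξ hξ' I).trans (outcomeNorm_le (hC n M hM) hξ))
      hY⟩ ⟨X, hX, rfl⟩

theorem outcomeNorm_le_bodyNorm {C : POVMSet ι}
    (hC : ∀ (n : ℕ) (M : Fin n → Op ι), M ∈ C n → IsPOVM M)
    {ξ : Op ι} (hξ : ξ.IsHermitian) (hξ' : ξ.trace = 0) {n : ℕ} {M : Fin n → Op ι} (hM : M ∈ C n) :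
    outcomeNorm M ξ ≤ bodyNorm (body C) ξ := by
  obtain ⟨I, hI⟩ := exists_generator_eq_outcomeNorm (hC n M hM) hξ hξ'
  rw [hI]
  exact (Complex.re_le_norm _).trans (le_bodyNorm hC hξ hξ' (generator_mem_body hM I))

/-- On traceless Hermitian operators the norm of a set of POVMs is that of its convex body. -/
theorem povmSetNorm_eq_bodyNorm {C : POVMSet ι}
    (hC : ∀ (n : ℕ) (M : Fin n → Op ι), M ∈ C n → IsPOVM M)
    {ξ : Op ι} (hξ : ξ.IsHermitian) (hξ' : ξ.trace = 0) :
    povmSetNorm C ξ = bodyNorm (body C) ξ := by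
  refine le_antisymm (Real.sSup_le (fun r hr => ?_) (bodyNorm_nonneg _ _))
    (bodyNorm_le (povmSetNorm_nonneg _ _) fun n M I hM => ?_)
  · obtain ⟨n, M, hM, rfl⟩ := hr
    exact outcomeNorm_le_bodyNorm hC hξ hξ' hM
  · refine (norm_trace_mul_generator_le (hC n M hM) hξ hξ' I).trans (le_csSup ?_ ⟨n, M, hM, rfl⟩)
    refine ⟨∑ i, |hξ.eigenvalues i|, fun r hr => ?_⟩
    obtain ⟨m, M', hM', rfl⟩ := hr
    exact outcomeNorm_le (hC m M' hM') hξ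

/-- If the groupings of the POVMs in `C` are groupings of POVMs in `C'`, then the norm of `C` is
at most that of `C'`. -/
theorem bodyNorm_mono {C C' : POVMSet ι}
    (hC' : ∀ (n : ℕ) (M : Fin n → Op ι), M ∈ C' n → IsPOVM M)
    (h : ∀ (n : ℕ) (M : Fin n → Op ι) (I : Finset (Fin n)), M ∈ C n →
      ∃ (m : ℕ) (M' : Fin m → Op ι) (I' : Finset (Fin m)), M' ∈ C' m ∧
        ∑ k ∈ I, M k = ∑ k ∈ I', M' k)
    {ξ : Op ι} (hξ : ξ.IsHermitian) (hξ' : ξ.trace = 0) :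
    bodyNorm (body C) ξ ≤ bodyNorm (body C') ξ := by
  refine bodyNorm_le (bodyNorm_nonneg _ _) fun n M I hM => ?_
  obtain ⟨m, M', I', hM', hI⟩ := h n M I hM
  rw [hI]
  exact le_bodyNorm hC' hξ hξ' (generator_mem_body hM' I')

end Body

/-! ### Relations between the classes of measurements -/

theorem exists_eq_conjTranspose_mul_self {ι : Type} [Fintype ι] [DecidableEq ι] {A : Op ι}
    (hA : A.PosSemidef) : ∃ K : Op ι, A = Kᴴ * K := by
  refine ⟨Matrix.diagonal (fun i => (Real.sqrt (hA.1.eigenvalues i) : ℂ)) *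
    (hA.1.eigenvectorUnitary : Op ι)ᴴ, ?_⟩
  conv_lhs => rw [hermitian_eq_conj_diagonal hA.1]
  have h : Matrix.diagonal (fun i => (hA.1.eigenvalues i : ℂ)) =
      (Matrix.diagonal (fun i => (Real.sqrt (hA.1.eigenvalues i) : ℂ)))ᴴ *
        Matrix.diagonal (fun i => (Real.sqrt (hA.1.eigenvalues i) : ℂ)) := by
    rw [Matrix.diagonal_conjTranspose, Matrix.diagonal_mul_diagonal]
    congr 1
    funext i
    simp [← Complex.ofReal_mul, Real.mul_self_sqrt (hA.eigenvalues_nonneg i)]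
  rw [h, Matrix.conjTranspose_mul]
  simp only [Matrix.mul_assoc]

theorem trace_mul_re_nonneg {ι : Type} [Fintype ι] [DecidableEq ι] {A B : Op ι}
    (hA : A.PosSemidef) (hB : B.PosSemidef) : 0 ≤ (A * B).trace.re := by
  obtain ⟨K, rfl⟩ := exists_eq_conjTranspose_mul_self hA
  rw [Matrix.mul_assoc, Matrix.trace_mul_comm]
  exact (Complex.le_def.1 (hB.mul_mul_conjTranspose_same K).trace_nonneg).1

theorem sum_kronecker_sum {p q a b : Type} [Fintype p] [Fintype q] (A : p → Op a) (B : q → Op b) :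
    ∑ x : p × q, A x.1 ⊗ₖ B x.2 = (∑ i, A i) ⊗ₖ (∑ j, B j) := by
  ext u v
  simp only [Matrix.sum_apply, Matrix.kroneckerMap_apply, Fintype.sum_prod_type, Finset.sum_mul_sum]

theorem conj_kronecker {a a' b b' : Type} [Fintype a] [Fintype a'] [Fintype b] [Fintype b']
    (K : Matrix a' a ℂ) (L : Matrix b' b ℂ) (A : Op a') (B : Op b') :
    (K ⊗ₖ L)ᴴ * (A ⊗ₖ B) * (K ⊗ₖ L) = (Kᴴ * A * K) ⊗ₖ (Lᴴ * B * L) := by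
  rw [Matrix.conjTranspose_kronecker, ← Matrix.mul_kronecker_mul, ← Matrix.mul_kronecker_mul]

section Classes

variable {a b : ℕ}

theorem isPOVM_of_mem_LO (n : ℕ) (M : Fin n → Op (Bi a b)) (hM : M ∈ LO a b n) : IsPOVM M := by
  obtain ⟨p, q, A, B, e, hA, hB, h⟩ := hM
  refine ⟨fun k => by rw [h]; exact (hA.1 _).kronecker (hB.1 _), ?_⟩
  simp only [h]
  rw [Equiv.sum_comp e (fun x => A x.1 ⊗ₖ B x.2), sum_kronecker_sum, hA.2, hB.2,
    Matrix.one_kronecker_one]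

theorem isPOVM_of_mem_SEP (n : ℕ) (M : Fin n → Op (Bi a b)) (hM : M ∈ SEP a b n) : IsPOVM M := by
  obtain ⟨A, B, hA, hB, h, h1⟩ := hM
  exact ⟨fun k => by rw [h]; exact (hA _).kronecker (hB _), h1⟩

theorem isPOVM_of_mem_PPT (n : ℕ) (M : Fin n → Op (Bi a b)) (hM : M ∈ PPT a b n) : IsPOVM M :=
  hM.1

/-- The protocol: Alice measures with Kraus operators Kᵢ, where Aᵢ = Kᵢ†Kᵢ, Bob measures with Lⱼ
independently of i, and the pair (i, j) is announced. -/
theorem mem_LOCC_of_mem_LO (n : ℕ) (M : Fin n → Op (Bi a b)) (hM : M ∈ LO a b n) :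
    M ∈ LOCC a b n := by
  obtain ⟨p, q, A, B, e, hA, hB, h⟩ := hM
  choose K hK using fun i => exists_eq_conjTranspose_mul_self (hA.1 i)
  choose L hL using fun j => exists_eq_conjTranspose_mul_self (hB.1 j)
  have h1 := IsLOCC.alice a b n p (fun _ => a) K (by rw [← hA.2]; simp only [hK])
    (fun i k => ∑ j, ((1 : Op (Fin a)) ⊗ₖ L j)ᴴ * (if k = e.symm (i, j) then 1 else 0) *
      ((1 : Op (Fin a)) ⊗ₖ L j))
    (fun i => IsLOCC.bob a b n q (fun _ => b) L (by rw [← hB.2]; simp only [hL]) _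
      fun j => IsLOCC.announce a b n (e.symm (i, j)))
  change IsLOCC a b n M
  convert h1 using 1
  funext k
  have h2 : ∀ i j, ((1 : Op (Fin a)) ⊗ₖ L j)ᴴ * (if k = e.symm (i, j) then 1 else 0) *
      ((1 : Op (Fin a)) ⊗ₖ L j) = if e k = (i, j) then (1 : Op (Fin a)) ⊗ₖ B j else 0 :=
    fun i j => by
      simp only [Equiv.eq_symm_apply]
      split_ifs
      · rw [← Matrix.one_kronecker_one, conj_kronecker, hL]
        simp
      · simp
  simp only [h2]
  rw [h]
  have h3 : ∀ i, (K i ⊗ₖ (1 : Op (Fin b)))ᴴ *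
      (∑ j, if e k = (i, j) then (1 : Op (Fin a)) ⊗ₖ B j else 0) * (K i ⊗ₖ (1 : Op (Fin b))) =
      ∑ j, if e k = (i, j) then A i ⊗ₖ B j else 0 := fun i => by
    rw [Matrix.mul_sum, Matrix.sum_mul]
    refine Finset.sum_congr rfl fun j _ => ?_
    split_ifs
    · rw [conj_kronecker, hK]
      simp
    · simp
  simp only [h3]
  rw [← Fintype.sum_prod_type' (f := fun i j => if e k = (i, j) then A i ⊗ₖ B j else 0)]
  simp

/-- The operators `M k` are obtained by grouping the elements of a separable POVM. -/
def IsSepGrouping {n : ℕ} (M : Fin n → Op (Bi a b)) : Prop :=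
  ∃ (κ : Type) (_ : Fintype κ) (A : κ → Op (Fin a)) (B : κ → Op (Fin b)) (f : κ → Fin n),
    (∀ j, (A j).PosSemidef) ∧ (∀ j, (B j).PosSemidef) ∧
    (∀ k, M k = ∑ j, if f j = k then A j ⊗ₖ B j else 0) ∧ ∑ j, A j ⊗ₖ B j = 1

end Classes

/-- Conjugation by K ⊗ 1 or 1 ⊗ K keeps product operators product, so the fine-grained outcomes (i,
outcome of branch i) of a round again form a separable POVM. Grouping is needed because different
branches may announce the same outcome, and a sum of product operators need not be a product. -/
theorem isSepGrouping_of_isLOCC {a b n : ℕ} {M : Fin n → Op (Bi a b)} (hM : IsLOCC a b n M) :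
    IsSepGrouping M := by
  induction hM with
  | announce a b n k =>
    refine ⟨Unit, inferInstance, fun _ => 1, fun _ => 1, fun _ => k, fun _ => Matrix.PosSemidef.one,
      fun _ => Matrix.PosSemidef.one, fun j => ?_, ?_⟩
    · simp [eq_comm]
    · simp
  | alice a b n m a' K hK N hN ih =>
    choose κ hκ A B f hA hB h h1 using ih
    refine ⟨Σ i, κ i, inferInstance, fun x => (K x.1)ᴴ * A x.1 x.2 * K x.1, fun x => B x.1 x.2,
      fun x => f x.1 x.2, fun x => (hA _ _).conjTranspose_mul_mul_same _, fun x => hB _ _,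
      fun k => ?_, ?_⟩
    · rw [Fintype.sum_sigma]
      refine Finset.sum_congr rfl fun i _ => ?_
      rw [h, Matrix.mul_sum, Matrix.sum_mul]
      refine Finset.sum_congr rfl fun j _ => ?_
      split_ifs
      · rw [conj_kronecker]; simp
      · simp
    · rw [Fintype.sum_sigma]
      have h2 : ∀ i, ∑ j, ((K i)ᴴ * A i j * K i) ⊗ₖ B i j =
          ((K i)ᴴ * K i) ⊗ₖ (1 : Op (Fin b)) := fun i => by
        have h3 : ∀ j, ((K i)ᴴ * A i j * K i) ⊗ₖ B i j =
            (K i ⊗ₖ (1 : Op (Fin b)))ᴴ * (A i j ⊗ₖ B i j) * (K i ⊗ₖ (1 : Op (Fin b))) :=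
          fun j => by rw [conj_kronecker]; simp
        simp only [h3]
        rw [← Matrix.sum_mul, ← Matrix.mul_sum, h1, ← Matrix.one_kronecker_one, conj_kronecker]
        simp
      simp only [h2]
      ext u v
      have h4 := congrFun (congrFun hK u.1) v.1
      rw [Matrix.sum_apply] at h4
      simp only [Matrix.sum_apply, Matrix.kroneckerMap_apply]
      rw [← Finset.sum_mul, h4, ← Matrix.one_kronecker_one, Matrix.kroneckerMap_apply]
  | bob a b n m b' K hK N hN ih =>
    choose κ hκ A B f hA hB h h1 using ih
    refine ⟨Σ i, κ i, inferInstance, fun x => A x.1 x.2, fun x => (K x.1)ᴴ * B x.1 x.2 * K x.1,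
      fun x => f x.1 x.2, fun x => hA _ _, fun x => (hB _ _).conjTranspose_mul_mul_same _,
      fun k => ?_, ?_⟩
    · rw [Fintype.sum_sigma]
      refine Finset.sum_congr rfl fun i _ => ?_
      rw [h, Matrix.mul_sum, Matrix.sum_mul]
      refine Finset.sum_congr rfl fun j _ => ?_
      split_ifs
      · rw [conj_kronecker]; simp
      · simp
    · rw [Fintype.sum_sigma]
      have h2 : ∀ i, ∑ j, A i j ⊗ₖ ((K i)ᴴ * B i j * K i) =
          (1 : Op (Fin a)) ⊗ₖ ((K i)ᴴ * K i) := fun i => by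
        have h3 : ∀ j, A i j ⊗ₖ ((K i)ᴴ * B i j * K i) =
            ((1 : Op (Fin a)) ⊗ₖ K i)ᴴ * (A i j ⊗ₖ B i j) * ((1 : Op (Fin a)) ⊗ₖ K i) :=
          fun j => by rw [conj_kronecker]; simp
        simp only [h3]
        rw [← Matrix.sum_mul, ← Matrix.mul_sum, h1, ← Matrix.one_kronecker_one, conj_kronecker]
        simp
      simp only [h2]
      ext u v
      have h4 := congrFun (congrFun hK u.2) v.2
      rw [Matrix.sum_apply] at h4
      simp only [Matrix.sum_apply, Matrix.kroneckerMap_apply]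
      rw [← Finset.mul_sum, h4, ← Matrix.one_kronecker_one, Matrix.kroneckerMap_apply]

theorem exists_mem_SEP {a b : ℕ} {κ : Type} [Fintype κ] {A : κ → Op (Fin a)} {B : κ → Op (Fin b)}
    (hA : ∀ j, (A j).PosSemidef) (hB : ∀ j, (B j).PosSemidef) (h1 : ∑ j, A j ⊗ₖ B j = 1)
    (s : Finset κ) : ∃ (m : ℕ) (M : Fin m → Op (Bi a b)) (I : Finset (Fin m)), M ∈ SEP a b m ∧
      ∑ j ∈ s, A j ⊗ₖ B j = ∑ k ∈ I, M k := by
  let e := (Fintype.equivFin κ).symm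
  refine ⟨Fintype.card κ, fun k => A (e k) ⊗ₖ B (e k), s.map e.symm.toEmbedding,
    ⟨fun k => A (e k), fun k => B (e k), fun k => hA _, fun k => hB _, fun k => rfl, ?_⟩, ?_⟩
  · rw [← h1]
    exact Equiv.sum_comp e (fun j => A j ⊗ₖ B j)
  · rw [Finset.sum_map]
    simp

theorem isPOVM_of_mem_LOCC {a b : ℕ} (n : ℕ) (M : Fin n → Op (Bi a b)) (hM : M ∈ LOCC a b n) :
    IsPOVM M := by
  obtain ⟨κ, _, A, B, f, hA, hB, h, h1⟩ := isSepGrouping_of_isLOCC hM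
  refine ⟨fun k => ?_, ?_⟩
  · rw [h]
    refine Matrix.posSemidef_sum _ fun j _ => ?_
    split_ifs
    · exact (hA j).kronecker (hB j)
    · exact Matrix.PosSemidef.zero
  · simp only [h]
    rw [Finset.sum_comm, ← h1]
    simp

theorem exists_SEP_grouping_of_LOCC {a b : ℕ} (n : ℕ) (M : Fin n → Op (Bi a b))
    (I : Finset (Fin n)) (hM : M ∈ LOCC a b n) :
    ∃ (m : ℕ) (M' : Fin m → Op (Bi a b)) (I' : Finset (Fin m)), M' ∈ SEP a b m ∧
      ∑ k ∈ I, M k = ∑ k ∈ I', M' k := by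
  obtain ⟨κ, _, A, B, f, hA, hB, h, h1⟩ := isSepGrouping_of_isLOCC hM
  obtain ⟨m, M', I', hM', hI⟩ := exists_mem_SEP hA hB h1 (Finset.univ.filter fun j => f j ∈ I)
  refine ⟨m, M', I', hM', ?_⟩
  rw [← hI]
  simp only [h]
  rw [Finset.sum_comm, Finset.sum_filter]
  refine Finset.sum_congr rfl fun j _ => ?_
  rw [Finset.sum_ite_eq]

theorem transposeA_kronecker {a b : ℕ} (A : Op (Fin a)) (B : Op (Fin b)) :
    transposeA (A ⊗ₖ B) = Aᵀ ⊗ₖ B := rfl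

theorem transposeB_kronecker {a b : ℕ} (A : Op (Fin a)) (B : Op (Fin b)) :
    transposeB (A ⊗ₖ B) = A ⊗ₖ Bᵀ := rfl

theorem mem_PPT_of_mem_SEP {a b : ℕ} (n : ℕ) (M : Fin n → Op (Bi a b)) (hM : M ∈ SEP a b n) :
    M ∈ PPT a b n := by
  refine ⟨isPOVM_of_mem_SEP n M hM, fun k => ?_⟩
  obtain ⟨A, B, hA, hB, h, h1⟩ := hM
  rw [h, transposeA_kronecker, transposeB_kronecker]
  exact ⟨(hA k).transpose.kronecker (hB k), (hA k).kronecker (hB k).transpose,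
    ((hA k).kronecker (hB k)).transpose⟩

/-! ### The symmetric and the antisymmetric state -/

section Swap

variable {d : ℕ}

theorem swapOp_apply (p q : Fin d × Fin d) : swapOp d p q = if p = q.swap then 1 else 0 := by
  simp only [swapOp, Matrix.of_apply, Prod.ext_iff, Prod.fst_swap, Prod.snd_swap]

theorem swapOp_conjTranspose : (swapOp d)ᴴ = swapOp d := by
  ext p q
  rw [Matrix.conjTranspose_apply, swapOp_apply, swapOp_apply]
  have : q = p.swap ↔ p = q.swap := by
    constructor <;> (rintro rfl; simp)
  simp only [this]
  split_ifs <;> simp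

theorem trace_swapOp_mul (X : Op (Bi d d)) : (swapOp d * X).trace = ∑ p : Bi d d, X p p.swap := by
  rw [Matrix.trace_mul_comm]
  simp only [Matrix.trace, Matrix.diag, Matrix.mul_apply, swapOp_apply, mul_ite, mul_one, mul_zero]
  refine Finset.sum_congr rfl fun p _ => ?_
  simp

theorem swapOp_mul_self : swapOp d * swapOp d = 1 := by
  ext p q
  simp only [Matrix.mul_apply, swapOp_apply, mul_ite, mul_one, mul_zero]
  simp [Matrix.one_apply]

theorem trace_swapOp : (swapOp d).trace = d := by
  have := trace_swapOp_mul (1 : Op (Bi d d))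
  rw [Matrix.mul_one] at this
  rw [this, Fintype.sum_prod_type]
  simp only [Matrix.one_apply, Prod.swap_prod_mk, Prod.mk.injEq]
  have h : ∀ x y : Fin d, (x = y ∧ y = x) ↔ x = y := fun x y => ⟨fun h => h.1, fun h => ⟨h, h.symm⟩⟩
  simp [h]

theorem trace_one_bi : (1 : Op (Bi d d)).trace = (d : ℂ) * d := by
  simp [Matrix.trace_one]

theorem posSemidef_one_add_swapOp : (1 + swapOp d).PosSemidef := by
  have h := (Matrix.posSemidef_conjTranspose_mul_self (1 + swapOp d)).smul
    (show (0 : ℝ) ≤ 1 / 2 by norm_num)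
  convert h using 1
  rw [Matrix.conjTranspose_add, Matrix.conjTranspose_one, swapOp_conjTranspose]
  simp only [add_mul, mul_add, swapOp_mul_self, Matrix.one_mul, Matrix.mul_one]
  module

theorem posSemidef_one_sub_swapOp : (1 - swapOp d).PosSemidef := by
  have h := (Matrix.posSemidef_conjTranspose_mul_self (1 - swapOp d)).smul
    (show (0 : ℝ) ≤ 1 / 2 by norm_num)
  convert h using 1
  rw [Matrix.conjTranspose_sub, Matrix.conjTranspose_one, swapOp_conjTranspose]
  simp only [sub_mul, mul_sub, swapOp_mul_self, Matrix.one_mul, Matrix.mul_one]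
  module

theorem symState_eq : symState d = ((d * (d + 1) : ℝ)⁻¹) • (1 + swapOp d) := by
  ext p q
  simp [symState]
  ring

theorem antisymState_eq : antisymState d = ((d * (d - 1) : ℝ)⁻¹) • (1 - swapOp d) := by
  ext p q
  simp [antisymState]

theorem isState_symState (hd : 2 ≤ d) : IsState (symState d) := by
  have h2 : (2 : ℝ) ≤ d := by exact_mod_cast hd
  refine ⟨?_, ?_⟩
  · rw [symState_eq]
    exact posSemidef_one_add_swapOp.smul (by positivity)
  · rw [symState, Matrix.trace_smul, Matrix.trace_add, trace_swapOp, trace_one_bi, smul_eq_mul]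
    have h : (d : ℂ) * (d + 1) ≠ 0 := by norm_cast; positivity
    rw [inv_mul_eq_one₀ h]
    ring

theorem isState_antisymState (hd : 2 ≤ d) : IsState (antisymState d) := by
  have h2 : (2 : ℝ) ≤ d := by exact_mod_cast hd
  have h1 : (0 : ℝ) < d * (d - 1) := mul_pos (by linarith) (by linarith)
  refine ⟨?_, ?_⟩
  · rw [antisymState_eq]
    exact posSemidef_one_sub_swapOp.smul (by positivity)
  · rw [antisymState, Matrix.trace_smul, Matrix.trace_sub, trace_swapOp, trace_one_bi, smul_eq_mul]
    have h : (d : ℂ) * (d - 1) ≠ 0 := by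
      have := Complex.ofReal_ne_zero.2 h1.ne'
      push_cast at this
      exact this
    rw [inv_mul_eq_one₀ h]
    ring

theorem symState_mul_antisymState : symState d * antisymState d = 0 := by
  rw [symState, antisymState, smul_mul_smul_comm]
  simp only [add_mul, mul_sub, swapOp_mul_self, Matrix.one_mul, Matrix.mul_one]
  rw [add_comm (swapOp d) 1, sub_self, smul_zero]

/-- The difference of the symmetric and the antisymmetric state. -/
def hidingDiff (d : ℕ) : Op (Bi d d) := symState d - antisymState d

theorem isHermitian_hidingDiff (hd : 2 ≤ d) : (hidingDiff d).IsHermitian :=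
  (isState_symState hd).1.1.sub (isState_antisymState hd).1.1

theorem trace_hidingDiff (hd : 2 ≤ d) : (hidingDiff d).trace = 0 := by
  rw [hidingDiff, Matrix.trace_sub, (isState_symState hd).2, (isState_antisymState hd).2, sub_self]

theorem traceNorm_hidingDiff (hd : 2 ≤ d) : traceNorm (hidingDiff d) = 2 :=
  traceNorm_sub_of_orthogonal (isState_symState hd) (isState_antisymState hd)
    symState_mul_antisymState

theorem transposeA_sum {n : ℕ} (M : Fin n → Op (Bi d d)) (I : Finset (Fin n)) :
    transposeA (∑ k ∈ I, M k) = ∑ k ∈ I, transposeA (M k) := by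
  ext p q
  simp [transposeA, Matrix.sum_apply]

/-- tr(F X) is the expectation of the partial transpose of X in the unnormalised maximally entangled
vector ∑ |ii⟩. -/
theorem trace_swapOp_mul_re_nonneg {X : Op (Bi d d)} (hX : (transposeA X).PosSemidef) :
    0 ≤ (swapOp d * X).trace.re := by
  have h := hX.dotProduct_mulVec_nonneg (fun p => if p.1 = p.2 then 1 else 0)
  have h2 : star (fun p : Bi d d => if p.1 = p.2 then (1 : ℂ) else 0) ⬝ᵥ
      transposeA X *ᵥ (fun p => if p.1 = p.2 then 1 else 0) = (swapOp d * X).trace := by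
    rw [trace_swapOp_mul]
    simp only [dotProduct, Matrix.mulVec, Fintype.sum_prod_type, transposeA, Matrix.of_apply,
      Pi.star_apply, Prod.swap_prod_mk]
    simp only [mul_ite, mul_one, mul_zero, Finset.sum_ite_eq, Finset.mem_univ, if_true,
      apply_ite star, star_one, star_zero, ite_mul, one_mul, zero_mul]
    rw [Finset.sum_comm]
  rw [h2] at h
  exact (Complex.le_def.1 h).1

theorem trace_hidingDiff_mul_re (X : Op (Bi d d)) : (hidingDiff d * X).trace.re =
    (d * (d + 1) : ℝ)⁻¹ * (X.trace.re + (swapOp d * X).trace.re) -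
      (d * (d - 1) : ℝ)⁻¹ * (X.trace.re - (swapOp d * X).trace.re) := by
  rw [hidingDiff, symState_eq, antisymState_eq]
  simp only [sub_mul, Matrix.smul_mul, add_mul, Matrix.one_mul, Matrix.trace_sub,
    Matrix.trace_smul, Matrix.trace_add, Complex.sub_re, Complex.add_re, Complex.smul_re,
    smul_eq_mul]

/-- Let t = tr X and x = tr(F X). Positivity of X gives t − x ≥ 0, so enlarging the subtracted
coefficient 1/(d(d+1)) to 1/(d(d−1)) only helps, and the expression is at most 2x/(d(d+1)). The
partial transpose of 1 − X gives x ≤ tr F = d. -/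
theorem trace_hidingDiff_mul_re_le (hd : 2 ≤ d) {X : Op (Bi d d)} (h0 : X.PosSemidef)
    (h1 : (transposeA (1 - X)).PosSemidef) :
    (hidingDiff d * X).trace.re ≤ 2 / ((d : ℝ) + 1) := by
  have h2 : (2 : ℝ) ≤ d := by exact_mod_cast hd
  have hx := trace_swapOp_mul_re_nonneg h1
  have ht := trace_mul_re_nonneg posSemidef_one_sub_swapOp h0
  rw [Matrix.mul_sub, Matrix.mul_one, Matrix.trace_sub, trace_swapOp] at hx
  rw [sub_mul, Matrix.one_mul, Matrix.trace_sub] at ht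
  simp only [Complex.sub_re, Complex.natCast_re] at hx ht
  rw [trace_hidingDiff_mul_re]
  set t := X.trace.re
  set x := (swapOp d * X).trace.re
  have hle : (d * (d + 1) : ℝ)⁻¹ ≤ (d * (d - 1) : ℝ)⁻¹ :=
    inv_anti₀ (mul_pos (by linarith) (by linarith)) (by nlinarith)
  have h3 := mul_le_mul_of_nonneg_right hle ht
  have h4 : (d * (d + 1) : ℝ)⁻¹ * (2 * x) ≤ (d * (d + 1) : ℝ)⁻¹ * (2 * d) :=
    mul_le_mul_of_nonneg_left (by linarith) (by positivity)
  have h5 : (d * (d + 1) : ℝ)⁻¹ * (2 * d) = 2 / ((d : ℝ) + 1) := by field_simp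
  linarith

theorem bodyNorm_PPT_hidingDiff_le (hd : 2 ≤ d) :
    bodyNorm (body (PPT d d)) (hidingDiff d) ≤ 2 / ((d : ℝ) + 1) * 2 := by
  refine bodyNorm_le (by positivity) fun n M I hM => ?_
  have hM1 : ∑ k, M k = 1 := hM.1.2
  have hcompl : ∀ J : Finset (Fin n), ∑ k ∈ Jᶜ, M k = 1 - ∑ k ∈ J, M k := fun J => by
    rw [← hM1, ← Finset.sum_add_sum_compl J, add_sub_cancel_left]
  have hpsd : ∀ J : Finset (Fin n), (∑ k ∈ J, M k).PosSemidef := fun J =>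
    Matrix.posSemidef_sum _ fun k _ => hM.1.1 k
  have hpt : ∀ J : Finset (Fin n), (transposeA (∑ k ∈ J, M k)).PosSemidef := fun J => by
    rw [transposeA_sum]
    exact Matrix.posSemidef_sum _ fun k _ => (hM.2 k).1
  have hle : ∀ J : Finset (Fin n),
      (hidingDiff d * ∑ k ∈ J, M k).trace.re ≤ 2 / ((d : ℝ) + 1) := fun J =>
    trace_hidingDiff_mul_re_le hd (hpsd J) (by rw [← hcompl]; exact hpt _)
  have h1 := hle I
  -- Since `hidingDiff d` is traceless, the upper bound for the complement is a lower bound for I.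
  have h2 := hle Iᶜ
  rw [hcompl, Matrix.mul_sub, Matrix.mul_one, Matrix.trace_sub, trace_hidingDiff hd, zero_sub,
    Complex.neg_re] at h2
  rw [trace_mul_generator (trace_hidingDiff hd), ← Matrix.trace_sum, ← Matrix.mul_sum, norm_mul,
    norm_trace_mul_eq_abs (isHermitian_hidingDiff hd) (hpsd I).1, Complex.norm_ofNat, mul_comm]
  exact mul_le_mul_of_nonneg_right (abs_le.2 ⟨by linarith, h1⟩) (by norm_num)

end Swap

/-! ### Discretization of the isotropic POVM -/

theorem exists_fine_partition {X : Type} [PseudoMetricSpace X] [CompactSpace X]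
    [MeasurableSpace X] [OpensMeasurableSpace X] {δ : ℝ} (hδ : 0 < δ) :
    ∃ (p : ℕ) (E : Fin p → Set X) (c : Fin p → X), (∀ k, MeasurableSet (E k)) ∧
      Pairwise (Function.onFun Disjoint E) ∧ ⋃ k, E k = Set.univ ∧
      ∀ k, ∀ x ∈ E k, dist x (c k) < δ := by
  obtain ⟨t, -, ht, hcov⟩ := finite_cover_balls_of_compact (isCompact_univ (X := X)) hδ
  lift t to Finset X using ht
  let c : Fin t.card → X := fun k => (t.equivFin.symm k : X)
  refine ⟨t.card, disjointed fun k => Metric.ball (c k) δ, c, fun k => ?_,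
    disjoint_disjointed _, ?_,
    fun k x hx => disjointed_subset (fun k => Metric.ball (c k) δ) k hx⟩
  · exact disjointedRec (p := MeasurableSet)
      (fun _ _ ht => ht.diff Metric.isOpen_ball.measurableSet) Metric.isOpen_ball.measurableSet
  · rw [iUnion_disjointed]
    refine Set.eq_univ_of_univ_subset (hcov.trans ?_)
    refine Set.iUnion₂_subset fun x hx => ?_
    refine Set.subset_iUnion_of_subset (t.equivFin ⟨x, hx⟩) ?_
    simp [c]

/-- On a cell where f is within ε of z, both the integral of the norm and the norm of the integral
differ from ‖z‖ μ(E) by at most ε μ(E). -/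
theorem integral_norm_le_norm_integral_add {X : Type} [MeasurableSpace X] {μ : Measure X}
    [IsFiniteMeasure μ] {E : Set X} (hE : MeasurableSet E) {f : X → ℂ} (hf : IntegrableOn f E μ)
    {z : ℂ} {ε : ℝ} (h : ∀ x ∈ E, ‖f x - z‖ ≤ ε) :
    ∫ x in E, ‖f x‖ ∂μ ≤ ‖∫ x in E, f x ∂μ‖ + 2 * ε * μ.real E := by
  have h1 : ∫ x in E, ‖f x‖ ∂μ ≤ ∫ x in E, (‖z‖ + ε) ∂μ :=
    setIntegral_mono_on hf.norm (integrable_const _) hE fun x hx => by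
      have := norm_le_norm_add_norm_sub' (f x) z
      linarith [h x hx]
  have h2 : ‖∫ x in E, (f x - z) ∂μ‖ ≤ ε * μ.real E :=
    norm_setIntegral_le_of_norm_le_const (measure_lt_top _ _) h
  rw [integral_sub hf (integrable_const _)] at h2
  simp only [integral_const, measureReal_restrict_apply_univ, smul_eq_mul] at h1 h2
  have h3 : ‖μ.real E • z‖ = μ.real E * ‖z‖ := by
    rw [norm_smul, Real.norm_of_nonneg measureReal_nonneg]
  have h4 := norm_le_norm_add_norm_sub' (μ.real E • z) (∫ x in E, f x ∂μ)
  rw [norm_sub_rev, h3] at h4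
  nlinarith

theorem exists_partition_integral_norm_le {X : Type} [PseudoMetricSpace X] [CompactSpace X]
    [MeasurableSpace X] [BorelSpace X] [T2Space X] [SecondCountableTopology X] (μ : Measure X)
    [IsProbabilityMeasure μ] {f : X × X → ℂ} (hf : Continuous f) {ε : ℝ} (hε : 0 < ε) :
    ∃ (p : ℕ) (E : Fin p → Set X), (∀ k, MeasurableSet (E k)) ∧
      Pairwise (Function.onFun Disjoint E) ∧ ⋃ k, E k = Set.univ ∧
      ∫ ω, ‖f ω‖ ∂μ.prod μ ≤ (∑ x : Fin p × Fin p, ‖∫ ω in E x.1 ×ˢ E x.2, f ω ∂μ.prod μ‖) + ε := by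
  have hfi : Integrable f (μ.prod μ) := integrable_of_continuous_compact hf
  -- Oscillation ε/2 suffices: a cell loses at most twice that times its measure, and the measures
  -- sum to 1.
  obtain ⟨δ, hδ, hδf⟩ := Metric.uniformContinuous_iff.1
    (CompactSpace.uniformContinuous_of_continuous hf) (ε / 2) (by positivity)
  obtain ⟨p, E, c, hE, hdisj, hun, hdist⟩ := exists_fine_partition (X := X) hδ
  refine ⟨p, E, hE, hdisj, hun, ?_⟩
  let G : Fin p × Fin p → Set (X × X) := fun x => E x.1 ×ˢ E x.2
  have hG : ∀ x, MeasurableSet (G x) := fun x => (hE _).prod (hE _)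
  have hGdisj : Pairwise (Function.onFun Disjoint G) := fun x y hxy => by
    rw [Function.onFun, Set.disjoint_prod]
    by_cases h : x.1 = y.1
    · exact Or.inr (hdisj fun h' => hxy (Prod.ext h h'))
    · exact Or.inl (hdisj h)
  have hGun : ⋃ x, G x = Set.univ := by
    refine Set.eq_univ_of_forall fun ω => ?_
    obtain ⟨k, hk⟩ := Set.mem_iUnion.1 (hun ▸ Set.mem_univ ω.1)
    obtain ⟨l, hl⟩ := Set.mem_iUnion.1 (hun ▸ Set.mem_univ ω.2)
    exact Set.mem_iUnion.2 ⟨(k, l), hk, hl⟩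
  have hcell : ∀ x, ∫ ω in G x, ‖f ω‖ ∂μ.prod μ ≤
      ‖∫ ω in G x, f ω ∂μ.prod μ‖ +
        2 * (ε / 2) * (μ.prod μ).real (G x) := fun x => by
    refine integral_norm_le_norm_integral_add (hG x) hfi.integrableOn (z := f (c x.1, c x.2))
      fun ω hω => ?_
    rw [← dist_eq_norm]
    exact (hδf (Prod.dist_eq.trans_lt (max_lt (hdist _ _ hω.1) (hdist _ _ hω.2)))).le
  have hmeas : ∑ x, (μ.prod μ).real (G x) = 1 := by
    rw [← measureReal_iUnion_fintype hGdisj hG, hGun, probReal_univ]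
  calc ∫ ω, ‖f ω‖ ∂μ.prod μ
      = ∑ x, ∫ ω in G x, ‖f ω‖ ∂μ.prod μ := by
        rw [← integral_iUnion_fintype hG hGdisj fun x => hfi.norm.integrableOn, hGun,
          Measure.restrict_univ]
    _ ≤ ∑ x, (‖∫ ω in G x, f ω ∂μ.prod μ‖ +
        2 * (ε / 2) * (μ.prod μ).real (G x)) :=
        Finset.sum_le_sum fun x _ => hcell x
    _ = _ := by
        rw [Finset.sum_add_distrib, ← Finset.mul_sum, hmeas]
        ring

section Discretize

variable {d : ℕ}

theorem isotropic_posSemidef (ψ : UnitVec d) : (isotropic d ψ).PosSemidef := by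
  have h := (Matrix.posSemidef_vecMulVec_self_star ψ.1.ofLp).smul
    (show (0 : ℝ) ≤ d from Nat.cast_nonneg d)
  convert h using 1
  ext i j
  simp [isotropic, Matrix.vecMulVec_apply]

theorem continuous_isotropic_apply (i j : Fin d) :
    Continuous fun ψ : UnitVec d => isotropic d ψ i j := by
  have h := continuous_unitVec (d := d)
  have h' : ∀ i, Continuous fun ψ : UnitVec d => ψ.1.ofLp i := fun i =>
    (continuous_apply i).comp h
  simp only [isotropic, Matrix.smul_apply, Matrix.vecMulVec_apply]
  exact continuous_const.mul ((h' i).mul (h' j).star)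

theorem trace_mul_isotropic_single (H : Op (Fin d)) (ψ : UnitVec d) :
    (H * isotropic d ψ).trace = d * (star ψ.1.ofLp ⬝ᵥ H *ᵥ ψ.1.ofLp) := by
  have h : isotropic d ψ = (d : ℂ) • Matrix.vecMulVec ψ.1.ofLp (star ψ.1.ofLp) := rfl
  rw [h, Matrix.mul_smul, Matrix.trace_smul, Matrix.mul_vecMulVec, Matrix.trace_vecMulVec,
    dotProduct_comm, smul_eq_mul]

/-- The element `∫_E d |ψ⟩⟨ψ| dψ` of a coarse-graining of the isotropic POVM. -/
def isotropicCell (d : ℕ) (E : Set (UnitVec d)) : Op (Fin d) :=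
  Matrix.of fun i j => ∫ ψ in E, isotropic d ψ i j ∂uniformUnit d

theorem continuous_trace_mul_isotropic (ξ : Op (Bi d d)) :
    Continuous fun ω : UnitVec d × UnitVec d =>
      (ξ * (isotropic d ω.1 ⊗ₖ isotropic d ω.2)).trace := by
  simp only [Matrix.trace, Matrix.diag, Matrix.mul_apply, Matrix.kroneckerMap_apply]
  exact continuous_finsetSum _ fun p _ => continuous_finsetSum _ fun q _ => continuous_const.mul
    (((continuous_isotropic_apply _ _).comp continuous_fst).mul
      ((continuous_isotropic_apply _ _).comp continuous_snd))

variable [NeZero d]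

theorem integrableOn_isotropic (i j : Fin d) (E : Set (UnitVec d)) :
    IntegrableOn (fun ψ => isotropic d ψ i j) E (uniformUnit d) :=
  (integrable_of_continuous_compact (continuous_isotropic_apply i j)).integrableOn

theorem trace_mul_isotropicCell (H : Op (Fin d)) (E : Set (UnitVec d)) :
    (H * isotropicCell d E).trace = ∫ ψ in E, (H * isotropic d ψ).trace ∂uniformUnit d := by
  have hint : ∀ i j, IntegrableOn (fun ψ => H i j * isotropic d ψ j i) E (uniformUnit d) :=
    fun i j => (integrableOn_isotropic j i E).const_mul _
  simp only [Matrix.trace, Matrix.diag, Matrix.mul_apply, isotropicCell, Matrix.of_apply]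
  rw [integral_finsetSum _ fun i _ => integrable_finsetSum _ fun j _ => hint i j]
  refine Finset.sum_congr rfl fun i _ => ?_
  rw [integral_finsetSum _ fun j _ => hint i j]
  simp only [integral_const_mul]

theorem isotropicCell_posSemidef (E : Set (UnitVec d)) : (isotropicCell d E).PosSemidef := by
  refine Matrix.PosSemidef.of_dotProduct_mulVec_nonneg ?_ fun x => ?_
  · ext i j
    simp only [Matrix.conjTranspose_apply, isotropicCell, Matrix.of_apply]
    rw [Complex.star_def, ← integral_conj]
    simp only [← Complex.star_def, (isotropic_posSemidef _).1.apply]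
  · have h : star x ⬝ᵥ isotropicCell d E *ᵥ x =
        ∫ ψ in E, (Matrix.vecMulVec x (star x) * isotropic d ψ).trace ∂uniformUnit d := by
      rw [← trace_mul_isotropicCell, Matrix.trace_mul_comm, Matrix.mul_vecMulVec,
        Matrix.trace_vecMulVec, dotProduct_comm]
    rw [h]
    have h2 : ∀ ψ : UnitVec d, (Matrix.vecMulVec x (star x) * isotropic d ψ).trace =
        (((star x ⬝ᵥ isotropic d ψ *ᵥ x).re : ℝ) : ℂ) := fun ψ => by
      rw [Matrix.trace_mul_comm, Matrix.mul_vecMulVec, Matrix.trace_vecMulVec, dotProduct_comm]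
      have := Complex.le_def.1 ((isotropic_posSemidef ψ).dotProduct_mulVec_nonneg x)
      exact Complex.ext rfl (by simpa using this.2.symm)
    simp only [h2]
    rw [integral_complex_ofReal, Complex.zero_le_real]
    exact integral_nonneg fun ψ =>
      (Complex.le_def.1 ((isotropic_posSemidef ψ).dotProduct_mulVec_nonneg x)).1

/-- The first spherical moment says tr(HS) = tr H for every Hermitian H. Taking H = S − 1 gives ‖S −
1‖₂² = tr((S − 1)S) − tr(S − 1) = 0. -/
theorem isotropicCell_univ : isotropicCell d Set.univ = 1 := by
  set S := isotropicCell d Set.univ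
  have hS : S.IsHermitian := (isotropicCell_posSemidef _).1
  have hd : (d : ℝ) ≠ 0 := Nat.cast_ne_zero.2 (NeZero.ne d)
  have key : ∀ H : Op (Fin d), H.IsHermitian → (H * S).trace.re = H.trace.re := fun H hH => by
    have h := sphere_moment hH 1
    rw [(gaussMoment_eq _).2.1, (gaussMoment_eq _).2.1] at h
    have hp : (Real.pi : ℝ) ^ d ≠ 0 := by positivity
    have h1 : ∑ i, hH.eigenvalues i =
        (∫ ψ : UnitVec d, quadForm H ψ.1.ofLp ∂uniformUnit d) * d := by
      apply mul_left_cancel₀ hp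
      rw [h]
      simp
      ring
    have h2 : ∀ ψ : UnitVec d, (H * isotropic d ψ).trace =
        ((d * quadForm H ψ.1.ofLp : ℝ) : ℂ) := fun ψ => by
      refine Complex.ext ?_ ?_
      · rw [trace_mul_isotropic_single]
        simp [quadForm]
      · rw [trace_mul_im_eq_zero hH (isotropic_posSemidef ψ).1, Complex.ofReal_im]
    rw [trace_mul_isotropicCell, Measure.restrict_univ]
    simp only [h2]
    rw [integral_complex_ofReal, Complex.ofReal_re, integral_const_mul, mul_comm, ← h1,
      hH.trace_eq_sum_eigenvalues]
    simp
  have h1 := key _ (hS.sub Matrix.isHermitian_one)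
  have h2 : ((S - 1)ᴴ * (S - 1)).trace = (frobSq (S - 1) : ℂ) := trace_conjTranspose_mul_self _
  rw [(hS.sub Matrix.isHermitian_one).eq, Matrix.mul_sub, Matrix.mul_one, Matrix.trace_sub] at h2
  have h3 : frobSq (S - 1) = 0 := by
    have := congrArg Complex.re h2
    rw [Complex.sub_re, h1, sub_self, Complex.ofReal_re] at this
    exact this.symm
  have h4 : ∀ i j, (S - 1) i j = 0 := fun i j => by
    rw [frobSq, Finset.sum_eq_zero_iff_of_nonneg fun _ _ =>
      Finset.sum_nonneg fun _ _ => by positivity] at h3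
    have h5 := h3 i (Finset.mem_univ _)
    rw [Finset.sum_eq_zero_iff_of_nonneg fun _ _ => by positivity] at h5
    simpa using h5 j (Finset.mem_univ _)
  exact sub_eq_zero.1 (Matrix.ext h4)

theorem isPOVM_isotropicCell {p : ℕ} {E : Fin p → Set (UnitVec d)}
    (hE : ∀ k, MeasurableSet (E k)) (hdisj : Pairwise (Function.onFun Disjoint E))
    (hun : ⋃ k, E k = Set.univ) : IsPOVM fun k => isotropicCell d (E k) := by
  refine ⟨fun k => isotropicCell_posSemidef _, ?_⟩
  rw [← isotropicCell_univ, ← hun]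
  ext i j
  simp only [Matrix.sum_apply, isotropicCell, Matrix.of_apply]
  exact (integral_iUnion_fintype hE hdisj fun k => integrableOn_isotropic i j _).symm

theorem trace_mul_isotropicCell_kronecker (ξ : Op (Bi d d)) (E F : Set (UnitVec d)) :
    (ξ * (isotropicCell d E ⊗ₖ isotropicCell d F)).trace =
      ∫ ω in E ×ˢ F, (ξ * (isotropic d ω.1 ⊗ₖ isotropic d ω.2)).trace
        ∂(uniformUnit d).prod (uniformUnit d) := by
  have hint : ∀ p q : Bi d d, Integrable (fun ω : UnitVec d × UnitVec d =>
      ξ p q * (isotropic d ω.1 q.1 p.1 * isotropic d ω.2 q.2 p.2))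
      (((uniformUnit d).restrict E).prod ((uniformUnit d).restrict F)) := fun p q =>
    ((integrableOn_isotropic q.1 p.1 E).mul_prod (integrableOn_isotropic q.2 p.2 F)).const_mul _
  rw [← Measure.prod_restrict]
  simp only [Matrix.trace, Matrix.diag, Matrix.mul_apply, Matrix.kroneckerMap_apply]
  rw [integral_finsetSum _ fun p _ => integrable_finsetSum _ fun q _ => hint p q]
  refine Finset.sum_congr rfl fun p _ => ?_
  rw [integral_finsetSum _ fun q _ => hint p q]
  refine Finset.sum_congr rfl fun q _ => ?_
  rw [integral_const_mul, integral_prod_mul (μ := (uniformUnit d).restrict E)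
    (ν := (uniformUnit d).restrict F) (fun ψ => isotropic d ψ q.1 p.1)
    (fun φ => isotropic d φ q.2 p.2)]
  rfl

/-- The norm of the tensor product of two isotropic POVMs is dominated by that of the local
measurements. -/
theorem continuousOutcomeNorm_le_bodyNorm_LO {ξ : Op (Bi d d)} (hξ : ξ.IsHermitian)
    (hξ' : ξ.trace = 0) :
    continuousOutcomeNorm ((uniformUnit d).prod (uniformUnit d))
      (fun ω : UnitVec d × UnitVec d => isotropic d ω.1 ⊗ₖ isotropic d ω.2) ξ ≤
      bodyNorm (body (LO d d)) ξ := by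
  refine le_of_forall_pos_le_add fun ε hε => ?_
  obtain ⟨p, E, hE, hdisj, hun, hle⟩ :=
    exists_partition_integral_norm_le (uniformUnit d) (continuous_trace_mul_isotropic ξ) hε
  have hM : (fun k : Fin (p * p) => isotropicCell d (E (finProdFinEquiv.symm k).1) ⊗ₖ
      isotropicCell d (E (finProdFinEquiv.symm k).2)) ∈ LO d d (p * p) :=
    ⟨p, p, fun k => isotropicCell d (E k), fun k => isotropicCell d (E k), finProdFinEquiv.symm,
      isPOVM_isotropicCell hE hdisj hun, isPOVM_isotropicCell hE hdisj hun, fun _ => rfl⟩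
  have h1 := outcomeNorm_le_bodyNorm isPOVM_of_mem_LO hξ hξ' hM
  rw [outcomeNorm, Equiv.sum_comp finProdFinEquiv.symm (fun x : Fin p × Fin p =>
    ‖(ξ * (isotropicCell d (E x.1) ⊗ₖ isotropicCell d (E x.2))).trace‖)] at h1
  simp only [trace_mul_isotropicCell_kronecker] at h1
  exact hle.trans (by gcongr)

end Discretize

/-! ### Convex hulls of compact sets -/

/-- By Carathéodory, dim E + 1 points suffice, so the hull is the continuous image of the compact
product of a simplex with finitely many copies of s. -/
theorem isCompact_convexHull_of_isCompact {E : Type} [AddCommGroup E] [Module ℝ E]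
    [TopologicalSpace E] [ContinuousAdd E] [ContinuousSMul ℝ E] [FiniteDimensional ℝ E] {s : Set E}
    (hs : IsCompact s) : IsCompact (convexHull ℝ s) := by
  rcases s.eq_empty_or_nonempty with rfl | ⟨x₀, hx₀⟩
  · simp
  set N := Module.finrank ℝ E + 1
  have himg : convexHull ℝ s = (fun p : (Fin N → ℝ) × (Fin N → E) => ∑ i, p.1 i • p.2 i) ''
      (stdSimplex ℝ (Fin N) ×ˢ Set.univ.pi fun _ => s) := by
    ext x
    constructor
    · intro hx
      obtain ⟨ι, _, z, w, hz, haff, hw, hw1, hx⟩ := eq_pos_convex_span_of_mem_convexHull hx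
      have hcard : Fintype.card ι ≤ Fintype.card (Fin N) := by
        rw [Fintype.card_fin]
        exact haff.card_le_finrank_succ.trans (Nat.succ_le_succ (Submodule.finrank_le _))
      obtain ⟨e⟩ := Function.Embedding.nonempty_of_card_le hcard
      -- Shorter combinations are padded with weight 0 at the arbitrary point x₀ of s.
      refine ⟨(Function.extend e w 0, Function.extend e z fun _ => x₀), ⟨⟨fun i => ?_, ?_⟩, ?_⟩, ?_⟩
      · by_cases hi : ∃ j, e j = i
        · obtain ⟨j, rfl⟩ := hi
          simp only [e.injective.extend_apply]
          exact (hw j).le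
        · simp [Function.extend_apply' _ _ _ hi]
      · rw [← hw1]
        refine (Fintype.sum_of_injective e e.injective w _ (fun i hi => ?_) fun j => ?_).symm
        · simp only [Set.mem_range] at hi
          simp [Function.extend_apply' _ _ _ hi]
        · simp only [e.injective.extend_apply]
      · intro i _
        by_cases hi : ∃ j, e j = i
        · obtain ⟨j, rfl⟩ := hi
          simp only [e.injective.extend_apply]
          exact hz ⟨j, rfl⟩
        · simp only [Function.extend_apply' _ _ _ hi]
          exact hx₀
      · rw [← hx]
        refine (Fintype.sum_of_injective e e.injective _ _ (fun i hi => ?_) fun j => ?_).symm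
        · simp only [Set.mem_range] at hi
          simp [Function.extend_apply' _ _ _ hi]
        · simp only [e.injective.extend_apply]
    · rintro ⟨p, ⟨⟨hp0, hp1⟩, hps⟩, rfl⟩
      exact (convex_convexHull ℝ s).sum_mem (fun i _ => hp0 i) hp1
        fun i _ => subset_convexHull ℝ s (hps i (Set.mem_univ i))
  rw [himg]
  refine ((isCompact_stdSimplex ℝ (Fin N)).prod (isCompact_univ_pi fun _ => hs)).image ?_
  exact continuous_finsetSum _ fun i _ => ((continuous_apply i).comp continuous_fst).smul
    ((continuous_apply i).comp continuous_snd)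

/-! ### Operators dominated in numerical range -/

section NumericalRange

variable {ι : Type} [Fintype ι] [DecidableEq ι]

open scoped Matrix.Norms.L2Operator in
-- The Kz are the spectral projections of U, obtained by functional calculus from indicators of
-- points; these are continuous on the finite spectrum.
theorem unitary_eq_sum_smul_posSemidef {U : Op ι} (hU : U ∈ unitary (Op ι)) :
    ∃ (s : Finset ℂ) (K : ℂ → Op ι), (∀ z, (K z).PosSemidef) ∧ ∑ z ∈ s, K z = 1 ∧
      U = ∑ z ∈ s, z • K z ∧ ∀ z ∈ s, ‖z‖ ≤ 1 := by
  have hN : IsStarNormal U := ⟨by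
    rw [Commute, SemiconjBy, Unitary.star_mul_self_of_mem hU, Unitary.mul_star_self_of_mem hU]⟩
  have hfin := Matrix.finite_spectrum U
  have hcont : ∀ f : ℂ → ℂ, ContinuousOn f (spectrum ℂ U) := fun f => hfin.continuousOn f
  let ind : ℂ → ℂ → ℂ := fun z x => if x = z then 1 else 0
  refine ⟨hfin.toFinset, fun z => cfc (ind z) U, fun z => ?_, ?_, ?_, fun z hz => ?_⟩
  · have h : cfc (ind z) U = (cfc (ind z) U)ᴴ * cfc (ind z) U := by
      rw [← Matrix.star_eq_conjTranspose, ← cfc_star, ← cfc_mul _ _ _ (hcont _) (hcont _)]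
      refine cfc_congr fun x _ => ?_
      simp only [ind]
      split_ifs <;> simp
    change (cfc (ind z) U).PosSemidef
    rw [h]
    exact Matrix.posSemidef_conjTranspose_mul_self _
  · rw [← cfc_sum _ _ _ fun z _ => hcont _, ← cfc_one ℂ U]
    refine cfc_congr fun x hx => ?_
    rw [Finset.sum_apply]
    simp [ind, hx]
  · have h : ∀ z, z • cfc (ind z) U = cfc (fun x => z • ind z x) U := fun z =>
      (cfc_smul z (ind z) U (hcont _)).symm
    simp only [h]
    rw [← cfc_sum _ _ _ fun z _ => hcont _]
    conv_lhs => rw [← cfc_id ℂ U]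
    refine cfc_congr fun x hx => ?_
    rw [Finset.sum_apply]
    simp [ind, hx]
  · have := spectrum.subset_circle_of_unitary hU (hfin.mem_toFinset.1 hz)
    rw [mem_sphere_zero_iff_norm] at this
    exact this.le

theorem norm_trace_posSemidef_mul_le {K C P : Op ι} (hK : K.PosSemidef)
    (h : ∀ x : ι → ℂ, ‖star x ⬝ᵥ C *ᵥ x‖ ≤ quadForm P x) : ‖(K * C).trace‖ ≤ (K * P).trace.re := by
  obtain ⟨S, rfl⟩ := exists_eq_conjTranspose_mul_self hK
  have h1 : ∀ Y : Op ι, (Sᴴ * S * Y).trace =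
      ∑ i, star (fun j => star (S i j)) ⬝ᵥ Y *ᵥ (fun j => star (S i j)) := fun Y => by
    rw [Matrix.mul_assoc, Matrix.trace_mul_comm, Matrix.trace]
    refine Finset.sum_congr rfl fun i _ => ?_
    rw [Matrix.diag_apply, Matrix.mul_assoc, Matrix.mul_apply]
    simp only [dotProduct, Matrix.mulVec, Matrix.mul_apply, Pi.star_apply, star_star,
      Matrix.conjTranspose_apply]
  rw [h1, h1, Complex.re_sum]
  exact (norm_sum_le _ _).trans (Finset.sum_le_sum fun i _ => h _)

/-- Domination of the numerical range passes to traces against each positive spectral projection of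
U. The eigenvalues have modulus at most one and the projections sum to 1. -/
theorem norm_trace_unitary_mul_le {U C P : Op ι} (hU : U ∈ unitary (Op ι))
    (h : ∀ x : ι → ℂ, ‖star x ⬝ᵥ C *ᵥ x‖ ≤ quadForm P x) : ‖(U * C).trace‖ ≤ P.trace.re := by
  obtain ⟨s, K, hK, hK1, rfl, hs⟩ := unitary_eq_sum_smul_posSemidef hU
  rw [Matrix.sum_mul, Matrix.trace_sum]
  have hP : P.trace.re = ∑ z ∈ s, (K z * P).trace.re := by
    rw [← Complex.re_sum, ← Matrix.trace_sum, ← Matrix.sum_mul, hK1, Matrix.one_mul]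
  rw [hP]
  refine (norm_sum_le _ _).trans (Finset.sum_le_sum fun z hz => ?_)
  rw [Matrix.smul_mul, Matrix.trace_smul, norm_smul]
  exact (mul_le_of_le_one_left (norm_nonneg _) (hs z hz)).trans
    (norm_trace_posSemidef_mul_le (hK z) h)

theorem exists_posSemidef_mul_self {A : Op ι} (hA : A.PosSemidef) :
    ∃ P : Op ι, P.PosSemidef ∧ P * P = A := by
  set U : Op ι := (hA.1.eigenvectorUnitary : Op ι)
  set D : Op ι := Matrix.diagonal fun i => (Real.sqrt (hA.1.eigenvalues i) : ℂ)
  have hu : Uᴴ * U = 1 := (Matrix.mem_unitaryGroup_iff'.1 hA.1.eigenvectorUnitary.2)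
  have hD : D.PosSemidef := Matrix.PosSemidef.diagonal fun i => by
    simp [Real.sqrt_nonneg]
  refine ⟨U * D * Uᴴ, hD.mul_mul_conjTranspose_same U, ?_⟩
  have h : D * D = Matrix.diagonal fun i => (hA.1.eigenvalues i : ℂ) := by
    rw [Matrix.diagonal_mul_diagonal]
    congr 1
    funext i
    simp [← Complex.ofReal_mul, Real.mul_self_sqrt (hA.eigenvalues_nonneg i)]
  conv_rhs => rw [hermitian_eq_conj_diagonal hA.1, ← h]
  rw [Matrix.conjTranspose_conjTranspose]
  simp only [Matrix.mul_assoc]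
  rw [← Matrix.mul_assoc Uᴴ U, hu, Matrix.one_mul]

/-- The polar decomposition C = (CR⁻¹)R with R = √(C†C) provides a unitary whose product with C is
R. Hence ‖C‖₁ = tr R ≤ tr P, and ‖C‖₂ ≤ ‖C‖₁. Invertibility makes the unitary factor explicit. -/
theorem frobSq_le_of_isUnit {C P : Op ι} (hC : IsUnit C.det)
    (h : ∀ x : ι → ℂ, ‖star x ⬝ᵥ C *ᵥ x‖ ≤ quadForm P x) : frobSq C ≤ P.trace.re ^ 2 := by
  obtain ⟨R, hR, hRR⟩ := exists_posSemidef_mul_self (Matrix.posSemidef_conjTranspose_mul_self C)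
  have hRdet : IsUnit R.det := by
    have h1 : R.det * R.det = Cᴴ.det * C.det := by rw [← Matrix.det_mul, hRR, Matrix.det_mul]
    have h2 : IsUnit (R.det * R.det) := by
      rw [h1, Matrix.det_conjTranspose]
      exact hC.star.mul hC
    exact isUnit_of_mul_isUnit_left h2
  have hRinv : (R⁻¹)ᴴ = R⁻¹ := by rw [Matrix.conjTranspose_nonsing_inv, hR.1.eq]
  have hU1 : (C * R⁻¹)ᴴ * (C * R⁻¹) = 1 := by
    rw [Matrix.conjTranspose_mul, hRinv, Matrix.mul_assoc, ← Matrix.mul_assoc Cᴴ, ← hRR,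
      Matrix.mul_assoc R, Matrix.mul_nonsing_inv _ hRdet, Matrix.mul_one,
      Matrix.nonsing_inv_mul _ hRdet]
  have hU : (C * R⁻¹)ᴴ ∈ unitary (Op ι) := by
    rw [Unitary.mem_iff]
    simp only [Matrix.star_eq_conjTranspose, Matrix.conjTranspose_conjTranspose]
    exact ⟨mul_eq_one_comm.1 hU1, hU1⟩
  have h1 := norm_trace_unitary_mul_le hU h
  have h2 : (C * R⁻¹)ᴴ * C = R := by
    rw [Matrix.conjTranspose_mul, hRinv, Matrix.mul_assoc, ← hRR, ← Matrix.mul_assoc,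
      Matrix.nonsing_inv_mul _ hRdet, Matrix.one_mul]
  rw [h2] at h1
  have h3 : frobSq C = frobSq R := by
    apply Complex.ofReal_injective
    rw [← trace_conjTranspose_mul_self, ← trace_conjTranspose_mul_self, hR.1.eq, hRR]
  have h4 : R.trace.re = ∑ i, hR.1.eigenvalues i := by
    rw [hR.1.trace_eq_sum_eigenvalues]
    simp
  have h5 := Finset.sum_sq_le_sq_sum_of_nonneg (s := Finset.univ) (f := hR.1.eigenvalues)
    (fun i _ => hR.eigenvalues_nonneg i)
  have h6 : 0 ≤ R.trace.re := (Complex.le_def.1 hR.trace_nonneg).1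
  rw [h3, frobSq_eq_sum_eigenvalues hR.1]
  refine h5.trans ?_
  rw [← h4]
  exact pow_le_pow_left₀ h6 ((Complex.re_le_norm _).trans h1) 2

/-- det(C + ε) is the characteristic polynomial of −C at ε, which has finitely many roots. -/
theorem eventually_isUnit_det_add_smul (C : Op ι) :
    ∀ᶠ ε : ℝ in nhdsWithin 0 (Set.Ioi 0), IsUnit (C + (ε : ℂ) • (1 : Op ι)).det := by
  have hfin : {z : ℂ | (-C).charpoly.IsRoot z}.Finite :=
    Polynomial.finite_setOfPred_isRoot (Matrix.charpoly_monic _).ne_zero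
  have h1 : ({z : ℂ | (-C).charpoly.IsRoot z} \ {0})ᶜ ∈ nhds (0 : ℂ) :=
    (hfin.subset Set.sdiff_subset).isClosed.isOpen_compl.mem_nhds (by simp)
  have h2 : Tendsto (fun ε : ℝ => (ε : ℂ)) (nhdsWithin 0 (Set.Ioi 0)) (nhds 0) := by
    have := Complex.continuous_ofReal.tendsto 0
    rw [Complex.ofReal_zero] at this
    exact this.mono_left nhdsWithin_le_nhds
  filter_upwards [h2 h1, self_mem_nhdsWithin] with ε hε hpos
  have hne : (ε : ℂ) ≠ 0 := Complex.ofReal_ne_zero.2 (ne_of_gt hpos)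
  rw [isUnit_iff_ne_zero]
  intro h0
  refine hε ⟨?_, hne⟩
  change Polynomial.eval _ _ = 0
  rw [Matrix.eval_charpoly, ← h0]
  congr 1
  rw [sub_neg_eq_add, add_comm, Matrix.smul_one_eq_diagonal]
  rfl

/-- Replacing C and P by C + ε and P + ε preserves the hypothesis, since both forms gain at most
ε‖x‖² and exactly ε‖x‖² respectively. Then ε → 0 removes the invertibility assumption. -/
theorem frobSq_le_sq_trace {C P : Op ι}
    (h : ∀ x : ι → ℂ, ‖star x ⬝ᵥ C *ᵥ x‖ ≤ quadForm P x) : frobSq C ≤ P.trace.re ^ 2 := by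
  have hev : ∀ᶠ ε : ℝ in nhdsWithin 0 (Set.Ioi 0), frobSq (C + (ε : ℂ) • (1 : Op ι)) ≤
      (P + (ε : ℂ) • (1 : Op ι)).trace.re ^ 2 := by
    filter_upwards [eventually_isUnit_det_add_smul C, self_mem_nhdsWithin] with ε hε hpos
    refine frobSq_le_of_isUnit hε fun x => ?_
    have hx : star x ⬝ᵥ ((ε : ℂ) • (1 : Op ι)) *ᵥ x = ((ε * ∑ i, ‖x i‖ ^ 2 : ℝ) : ℂ) := by
      rw [Matrix.smul_mulVec, Matrix.one_mulVec, dotProduct_smul, smul_eq_mul, dotProduct]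
      push_cast
      congr 1
      refine Finset.sum_congr rfl fun i _ => ?_
      rw [← Complex.conj_mul']
      rfl
    have h0 : 0 ≤ ε * ∑ i, ‖x i‖ ^ 2 := mul_nonneg (le_of_lt hpos) (by positivity)
    rw [quadForm, Matrix.add_mulVec, Matrix.add_mulVec, dotProduct_add, dotProduct_add, hx,
      Complex.add_re, Complex.ofReal_re]
    refine (norm_add_le _ _).trans ?_
    rw [Complex.norm_real, Real.norm_of_nonneg h0]
    exact add_le_add_left (h x) _
  have hc1 : Continuous fun ε : ℝ => frobSq (C + (ε : ℂ) • (1 : Op ι)) := by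
    simp only [frobSq, Matrix.add_apply, Matrix.smul_apply]
    fun_prop
  have hc2 : Continuous fun ε : ℝ => (P + (ε : ℂ) • (1 : Op ι)).trace.re ^ 2 := by
    simp only [Matrix.trace_add, Matrix.trace_smul]
    fun_prop
  have := le_of_tendsto_of_tendsto (hc1.tendsto 0 |>.mono_left nhdsWithin_le_nhds)
    (hc2.tendsto 0 |>.mono_left nhdsWithin_le_nhds) hev
  simpa using this

theorem trace_re_nonneg_of_quadForm {A : Op ι} (hA : ∀ x, 0 ≤ quadForm A x) : 0 ≤ A.trace.re := by
  rw [Matrix.trace, Complex.re_sum]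
  refine Finset.sum_nonneg fun i _ => ?_
  have := hA (Pi.single i 1)
  simpa [quadForm, Pi.star_single] using this

/-- If `|⟨x|C|x⟩|² ≤ ⟨x|A|x⟩ ⟨x|B|x⟩` for all `x`, then `‖C‖₂² ≤ tr A tr B`. -/
theorem frobSq_le_trace_mul_trace {A B C : Op ι} (hA : ∀ x, 0 ≤ quadForm A x)
    (hB : ∀ x, 0 ≤ quadForm B x)
    (h : ∀ x : ι → ℂ, ‖star x ⬝ᵥ C *ᵥ x‖ ^ 2 ≤ quadForm A x * quadForm B x) :
    frobSq C ≤ A.trace.re * B.trace.re := by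
  have hα := trace_re_nonneg_of_quadForm hA
  have hβ := trace_re_nonneg_of_quadForm hB
  have hF := Real.sqrt_nonneg (frobSq C)
  -- Weighted AM–GM dominates |⟨x|C|x⟩| by the form of (sA + s⁻¹B)/2, so `frobSq_le_sq_trace`
  -- applies for each s.
  have hpos : ∀ s : ℝ, 0 < s → 2 * Real.sqrt (frobSq C) ≤ s * A.trace.re + s⁻¹ * B.trace.re := by
    intro s hs
    have hsi : 0 < s⁻¹ := inv_pos.2 hs
    have h1 := frobSq_le_sq_trace (C := C) (P := ((s / 2 : ℝ) : ℂ) • A + ((s⁻¹ / 2 : ℝ) : ℂ) • B)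
      fun x => by
        have hq : quadForm (((s / 2 : ℝ) : ℂ) • A + ((s⁻¹ / 2 : ℝ) : ℂ) • B) x =
            (s * quadForm A x + s⁻¹ * quadForm B x) / 2 := by
          simp only [quadForm, Matrix.add_mulVec, Matrix.smul_mulVec, dotProduct_add,
            dotProduct_smul, smul_eq_mul, Complex.add_re, Complex.re_ofReal_mul]
          ring
        have hnn : 0 ≤ s * quadForm A x + s⁻¹ * quadForm B x :=
          add_nonneg (mul_nonneg hs.le (hA x)) (mul_nonneg hsi.le (hB x))
        rw [hq]
        refine le_of_sq_le_sq ((h x).trans ?_) (by positivity)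
        have h2 : s * s⁻¹ = 1 := mul_inv_cancel₀ hs.ne'
        have h3 : (s * quadForm A x) * (s⁻¹ * quadForm B x) = quadForm A x * quadForm B x := by
          rw [mul_mul_mul_comm, h2, one_mul]
        nlinarith [sq_nonneg (s * quadForm A x - s⁻¹ * quadForm B x)]
    rw [Matrix.trace_add, Matrix.trace_smul, Matrix.trace_smul, Complex.add_re, smul_eq_mul,
      smul_eq_mul, Complex.re_ofReal_mul, Complex.re_ofReal_mul] at h1
    have h2 := Real.sqrt_le_sqrt h1
    rw [Real.sqrt_sq (by positivity)] at h2
    linarith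
  -- Optimising over s through a discriminant also covers the case of a vanishing trace.
  have hquad : ∀ s : ℝ,
      0 ≤ A.trace.re * (s * s) + (-2 * Real.sqrt (frobSq C)) * s + B.trace.re := by
    intro s
    rcases le_or_gt s 0 with hs | hs
    · have h1 := mul_nonneg hF (neg_nonneg.2 hs)
      have h2 := mul_nonneg hα (mul_self_nonneg s)
      linarith
    · have h1 := mul_le_mul_of_nonneg_left (hpos s hs) hs.le
      have h2 : s * s⁻¹ = 1 := mul_inv_cancel₀ hs.ne'
      have h3 : s * (s * A.trace.re + s⁻¹ * B.trace.re) = A.trace.re * (s * s) + B.trace.re := by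
        rw [mul_add, ← mul_assoc s s⁻¹, h2]
        ring
      linarith
  have := discrim_le_zero hquad
  rw [discrim] at this
  have h2 := Real.sq_sqrt (frobSq_nonneg C)
  nlinarith

end NumericalRange

/-! ### The separable ball around the identity -/

section SeparableBall

variable {ι κ : Type} [Fintype ι] [DecidableEq ι] [Fintype κ] [DecidableEq κ]

theorem norm_apply_sq_le_of_posSemidef {M : Op ι} (hM : M.PosSemidef) (i j : ι) :
    ‖M i j‖ ^ 2 ≤ (M i i).re * (M j j).re := by
  obtain ⟨K, rfl⟩ := exists_eq_conjTranspose_mul_self hM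
  have h : ∀ a b, (Kᴴ * K) a b =
      inner ℂ (WithLp.toLp 2 fun k => K k a) (WithLp.toLp 2 fun k => K k b) := fun a b => by
    rw [EuclideanSpace.inner_eq_star_dotProduct, dotProduct_comm]
    rfl
  have h2 : ∀ a, ((Kᴴ * K) a a).re = ‖WithLp.toLp 2 fun k => K k a‖ ^ 2 := fun a => by
    rw [h, inner_self_eq_norm_sq_to_K]
    norm_cast
  rw [h2, h2, h, ← mul_pow]
  exact pow_le_pow_left₀ (norm_nonneg _) (norm_inner_le_norm _ _) 2

/-- A Hermitian operator with nonnegative expectations in product vectors satisfies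
`‖W‖₂ ≤ tr W`. -/
theorem frobSq_le_sq_trace_of_blockPositive {W : Op (ι × κ)} (hW : W.IsHermitian)
    (h : ∀ x y, 0 ≤ quadForm W (prodVec x y)) : frobSq W ≤ W.trace.re ^ 2 := by
  have hq : ∀ i j (y : κ → ℂ), contractB W y i j = star y ⬝ᵥ blockA W i j *ᵥ y := fun _ _ _ => rfl
  have hpsd : ∀ y, (contractB W y).PosSemidef := fun y => by
    refine Matrix.PosSemidef.of_dotProduct_mulVec_nonneg (isHermitian_contractB hW y) fun x => ?_
    refine Complex.le_def.2 ⟨?_, ?_⟩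
    · have := h x y
      rwa [← quadForm_contractB] at this
    · have h1 := star_dotProduct_mulVec (contractB W y) x
      rw [(isHermitian_contractB hW y).eq] at h1
      exact (Complex.conj_eq_iff_im.1 h1).symm
  have hdiag : ∀ i y, 0 ≤ quadForm (blockA W i i) y := fun i y => by
    rw [quadForm, ← hq]
    exact (Complex.le_def.1 ((hpsd y).diag_nonneg (i := i))).1
  -- Block positivity makes every contraction `contractB W y` positive semidefinite; its 2×2 minors
  -- are the pointwise inequality between the forms of the blocks.
  have hblock : ∀ i j, frobSq (blockA W i j) ≤
      (blockA W i i).trace.re * (blockA W j j).trace.re := fun i j =>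
    frobSq_le_trace_mul_trace (hdiag i) (hdiag j) fun y =>
      norm_apply_sq_le_of_posSemidef (hpsd y) i j
  have htr : W.trace.re = ∑ i, (blockA W i i).trace.re := by
    simp only [Matrix.trace, Matrix.diag, Fintype.sum_prod_type, Complex.re_sum]
    rfl
  rw [frobSq_eq_sum_blockA, htr, pow_two, Finset.sum_mul_sum]
  exact Finset.sum_le_sum fun i _ => Finset.sum_le_sum fun j _ => hblock i j

/-- The set of pure product states. -/
def pureProductStates (ι κ : Type) [Fintype ι] [Fintype κ] : Set (Op (ι × κ)) :=
  (fun p : EuclideanSpace ℂ ι × EuclideanSpace ℂ κ =>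
    Matrix.vecMulVec (prodVec p.1.ofLp p.2.ofLp) (star (prodVec p.1.ofLp p.2.ofLp))) ''
    (Metric.sphere 0 1 ×ˢ Metric.sphere 0 1)

theorem isCompact_pureProductStates (ι κ : Type) [Fintype ι] [Fintype κ] :
    IsCompact (pureProductStates ι κ) := by
  refine ((isCompact_sphere 0 1).prod (isCompact_sphere 0 1)).image ?_
  refine continuous_matrix fun p q => ?_
  simp only [Matrix.vecMulVec_apply, prodVec, Pi.star_apply]
  fun_prop

theorem trace_mul_vecMulVec_self {ι : Type} [Fintype ι] (X : Op ι) (v : ι → ℂ) :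
    (X * Matrix.vecMulVec v (star v)).trace = star v ⬝ᵥ X *ᵥ v := by
  rw [Matrix.mul_vecMulVec, Matrix.trace_vecMulVec, dotProduct_comm]

/-- The values of f at the matrix units and at i times them give the entries of a V that represents
f everywhere. On Hermitian X only the Hermitian part of V contributes to Re tr(VX). -/
theorem exists_hermitian_representation (f : Op ι →ₗ[ℝ] ℝ) :
    ∃ W : Op ι, W.IsHermitian ∧ ∀ X : Op ι, X.IsHermitian → f X = (W * X).trace.re := by
  let V : Op ι := Matrix.of fun j i =>
    (f (Matrix.single i j 1) : ℂ) - (f (Matrix.single i j Complex.I) : ℂ) * Complex.I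
  have hV : ∀ X : Op ι, f X = (V * X).trace.re := fun X => by
    have hs : ∀ i j (z : ℂ), f (Matrix.single i j z) = (V j i * z).re := fun i j z => by
      have hz : Matrix.single i j z =
          z.re • Matrix.single i j (1 : ℂ) + z.im • Matrix.single i j Complex.I := by
        rw [Matrix.smul_single, Matrix.smul_single, ← Matrix.single_add]
        congr 1
        simp [Complex.re_add_im]
      rw [hz, map_add, map_smul, map_smul]
      simp [V]
      ring
    conv_lhs => rw [Matrix.matrix_eq_sum_single X]
    simp only [map_sum, hs, Matrix.trace, Matrix.diag, Matrix.mul_apply, Complex.re_sum]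
    exact Finset.sum_comm
  refine ⟨hermPart V, isHermitian_hermPart V, fun X hX => ?_⟩
  have h1 : (Vᴴ * X).trace.re = (V * X).trace.re := by
    have : (Vᴴ * X).trace = star (V * X).trace := by
      rw [← Matrix.trace_conjTranspose, Matrix.conjTranspose_mul, hX.eq, Matrix.trace_mul_comm]
    rw [this]
    simp
  rw [hV, hermPart, Matrix.smul_mul, Matrix.trace_smul, add_mul, Matrix.trace_add, smul_eq_mul]
  have h2 : ((1 / 2 : ℂ) * ((V * X).trace + (Vᴴ * X).trace)).re =
      ((V * X).trace.re + (Vᴴ * X).trace.re) / 2 := by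
    rw [show (1 / 2 : ℂ) = ((1 / 2 : ℝ) : ℂ) by push_cast; rfl, Complex.re_ofReal_mul,
      Complex.add_re]
    ring
  rw [h2, h1]
  ring

theorem abs_trace_mul_re_le {ι : Type} [Fintype ι] (A B : Op ι) :
    |(A * B).trace.re| ≤ Real.sqrt (frobSq A) * Real.sqrt (frobSq B) := by
  have h : ‖(A * B).trace‖ ≤ ∑ p : ι × ι, ‖A p.1 p.2‖ * ‖B p.2 p.1‖ := by
    rw [Fintype.sum_prod_type]
    simp only [Matrix.trace, Matrix.diag, Matrix.mul_apply]
    refine (norm_sum_le _ _).trans (Finset.sum_le_sum fun i _ => ?_)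
    refine (norm_sum_le _ _).trans (Finset.sum_le_sum fun j _ => ?_)
    exact norm_mul_le _ _
  refine ((Complex.abs_re_le_norm _).trans h).trans ((Real.sum_mul_le_sqrt_mul_sqrt _ _ _).trans ?_)
  refine le_of_eq ?_
  rw [Fintype.sum_prod_type, Fintype.sum_prod_type, Finset.sum_comm (f := fun i j => ‖B j i‖ ^ 2)]
  rfl

theorem quadForm_prodVec_smul {ι κ : Type} [Fintype ι] [Fintype κ] (H : Op (ι × κ)) (a b : ℝ)
    (x : ι → ℂ) (y : κ → ℂ) :
    quadForm H (prodVec ((a : ℂ) • x) ((b : ℂ) • y)) = (a * b) ^ 2 * quadForm H (prodVec x y) := by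
  have h : prodVec ((a : ℂ) • x) ((b : ℂ) • y) = ((a * b : ℝ) : ℂ) • prodVec x y := by
    funext p
    simp only [prodVec, Pi.smul_apply, smul_eq_mul, Complex.ofReal_mul]
    ring
  rw [h, quadForm, Matrix.mulVec_smul, star_smul, smul_dotProduct, dotProduct_smul, smul_eq_mul,
    smul_eq_mul, ← mul_assoc, Complex.star_def, Complex.conj_ofReal, ← Complex.ofReal_mul,
    Complex.re_ofReal_mul, quadForm, pow_two]

theorem quadForm_prodVec_nonneg_of_unit {ι κ : Type} [Fintype ι] [Fintype κ] {H : Op (ι × κ)}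
    (h : ∀ (x : EuclideanSpace ℂ ι) (y : EuclideanSpace ℂ κ), ‖x‖ = 1 → ‖y‖ = 1 →
      0 ≤ quadForm H (prodVec x.ofLp y.ofLp)) (x : ι → ℂ) (y : κ → ℂ) :
    0 ≤ quadForm H (prodVec x y) := by
  by_cases hx : WithLp.toLp 2 x = (0 : EuclideanSpace ℂ ι)
  · have : x = 0 := by simpa using hx
    have h0 : prodVec (0 : ι → ℂ) y = 0 := by funext p; simp [prodVec]
    simp [this, h0, quadForm]
  by_cases hy : WithLp.toLp 2 y = (0 : EuclideanSpace ℂ κ)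
  · have : y = 0 := by simpa using hy
    have h0 : prodVec x (0 : κ → ℂ) = 0 := by funext p; simp [prodVec]
    simp [this, h0, quadForm]
  have key := h (((‖WithLp.toLp 2 x‖⁻¹ : ℝ) : ℂ) • WithLp.toLp 2 x)
    (((‖WithLp.toLp 2 y‖⁻¹ : ℝ) : ℂ) • WithLp.toLp 2 y)
    (by rw [norm_smul, Complex.norm_real, norm_inv, norm_norm,
      inv_mul_cancel₀ (norm_ne_zero_iff.2 hx)])
    (by rw [norm_smul, Complex.norm_real, norm_inv, norm_norm,
      inv_mul_cancel₀ (norm_ne_zero_iff.2 hy)])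
  rw [WithLp.ofLp_smul, WithLp.ofLp_smul, quadForm_prodVec_smul] at key
  refine nonneg_of_mul_nonneg_right key (pow_pos (mul_pos ?_ ?_) 2)
  · exact inv_pos.2 (norm_pos_iff.2 hx)
  · exact inv_pos.2 (norm_pos_iff.2 hy)

theorem star_dotProduct_self_prodVec {ι κ : Type} [Fintype ι] [Fintype κ]
    (x : EuclideanSpace ℂ ι) (y : EuclideanSpace ℂ κ) :
    star (prodVec x.ofLp y.ofLp) ⬝ᵥ prodVec x.ofLp y.ofLp = ((‖x‖ ^ 2 * ‖y‖ ^ 2 : ℝ) : ℂ) := by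
  rw [EuclideanSpace.norm_sq_eq, EuclideanSpace.norm_sq_eq, Finset.sum_mul_sum,
    ← Fintype.sum_prod_type' (f := fun i j => ‖x i‖ ^ 2 * ‖y j‖ ^ 2), dotProduct]
  push_cast
  refine Finset.sum_congr rfl fun p _ => ?_
  rw [← Complex.conj_mul', ← Complex.conj_mul']
  simp only [prodVec, Pi.star_apply, star_mul', Complex.star_def]
  ring

open scoped Matrix.Norms.L2Operator in
/-- The Gurvits–Barnum ball: traceless perturbations of Hilbert–Schmidt norm at most one keep the
identity separable. -/
theorem one_add_mem_convexHull [Nonempty ι] [Nonempty κ] {Δ : Op (ι × κ)} (hΔ : Δ.IsHermitian)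
    (hΔ0 : Δ.trace = 0) (hΔ1 : frobSq Δ ≤ 1) :
    ((Fintype.card (ι × κ) : ℝ)⁻¹) • (1 + Δ) ∈ convexHull ℝ (pureProductStates ι κ) := by
  have hD : 0 < (Fintype.card (ι × κ) : ℝ) := by exact_mod_cast Fintype.card_pos
  by_contra hx
  obtain ⟨f, u, hf1, hf2⟩ := geometric_hahn_banach_closed_point
    (convex_convexHull ℝ (pureProductStates ι κ))
    (isCompact_convexHull_of_isCompact (isCompact_pureProductStates ι κ)).isClosed hx
  obtain ⟨W, hW, hfW⟩ := exists_hermitian_representation (f : Op (ι × κ) →ₗ[ℝ] ℝ)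
  simp only [ContinuousLinearMap.coe_coe] at hfW
  have hone : (1 : Op (ι × κ)).IsHermitian := Matrix.isHermitian_one
  -- The separating functional becomes a block-positive G, so ‖G‖₂ ≤ tr G. With ‖Δ‖₂ ≤ 1 this forces
  -- tr(G(1 + Δ)) ≥ 0, whereas strict separation makes it negative.
  let G : Op (ι × κ) := (u : ℂ) • (1 : Op (ι × κ)) - W
  have hG : G.IsHermitian := by
    refine Matrix.IsHermitian.sub ?_ hW
    rw [Matrix.IsHermitian, Matrix.conjTranspose_smul, hone.eq, Complex.star_def,
      Complex.conj_ofReal]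
  have hblock : ∀ x y, 0 ≤ quadForm G (prodVec x y) := by
    refine quadForm_prodVec_nonneg_of_unit fun x y hx hy => ?_
    have h1 := hf1 _ (subset_convexHull ℝ (pureProductStates ι κ)
      ⟨(x, y), ⟨mem_sphere_zero_iff_norm.2 hx, mem_sphere_zero_iff_norm.2 hy⟩, rfl⟩)
    rw [hfW _ (Matrix.posSemidef_vecMulVec_self_star _).1, trace_mul_vecMulVec_self] at h1
    have h2 : quadForm G (prodVec x.ofLp y.ofLp) =
        u - (star (prodVec x.ofLp y.ofLp) ⬝ᵥ W *ᵥ prodVec x.ofLp y.ofLp).re := by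
      rw [quadForm, Matrix.sub_mulVec, Matrix.smul_mulVec, Matrix.one_mulVec, dotProduct_sub,
        dotProduct_smul, star_dotProduct_self_prodVec, hx, hy]
      simp
    rw [h2]
    exact sub_nonneg.2 h1.le
  have htr : 0 ≤ G.trace.re := by
    rw [Matrix.trace, Complex.re_sum]
    refine Finset.sum_nonneg fun p _ => ?_
    have h1 := hblock (Pi.single p.1 1) (Pi.single p.2 1)
    have h2 : prodVec (Pi.single p.1 1) (Pi.single p.2 1) = (Pi.single p 1 : ι × κ → ℂ) := by
      funext q
      simp only [prodVec, Pi.single_apply, Prod.ext_iff]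
      split_ifs <;> simp_all
    rw [h2] at h1
    simpa [quadForm, Pi.star_single] using h1
  have h1 : Real.sqrt (frobSq G) ≤ G.trace.re :=
    Real.sqrt_le_iff.2 ⟨htr, frobSq_le_sq_trace_of_blockPositive hG hblock⟩
  have h2 : |(G * Δ).trace.re| ≤ G.trace.re :=
    (abs_trace_mul_re_le G Δ).trans ((mul_le_of_le_one_right (Real.sqrt_nonneg _)
      (Real.sqrt_le_one.2 hΔ1)).trans h1)
  have h3 : (G * (1 + Δ)).trace.re = u * Fintype.card (ι × κ) - f (1 + Δ) := by
    rw [hfW _ (hone.add hΔ), sub_mul, Matrix.trace_sub, Complex.sub_re, Matrix.smul_mul,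
      Matrix.one_mul, Matrix.trace_smul, Matrix.trace_add, hΔ0, Matrix.trace_one]
    simp
  rw [mul_add, Matrix.mul_one, Matrix.trace_add, Complex.add_re] at h3
  rw [map_smul, smul_eq_mul, inv_mul_eq_div, lt_div_iff₀ hD] at hf2
  have := neg_le_of_abs_le h2
  linarith

end SeparableBall

/-! ### The lower bound for separable measurements -/

theorem vecMulVec_prodVec {ι κ : Type} (x : ι → ℂ) (y : κ → ℂ) :
    Matrix.vecMulVec (prodVec x y) (star (prodVec x y)) =
      Matrix.vecMulVec x (star x) ⊗ₖ Matrix.vecMulVec y (star y) := by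
  ext p q
  simp only [Matrix.vecMulVec_apply, Matrix.kroneckerMap_apply, prodVec, Pi.star_apply, star_mul']
  ring

theorem exists_sum_kronecker_of_mem_convexHull {ι κ : Type} [Fintype ι] [Fintype κ]
    {X : Op (ι × κ)} (hX : X ∈ convexHull ℝ (pureProductStates ι κ)) {r : ℝ} (hr : 0 ≤ r) :
    ∃ (τ : Type) (_ : Fintype τ) (A : τ → Op ι) (B : τ → Op κ), (∀ j, (A j).PosSemidef) ∧
      (∀ j, (B j).PosSemidef) ∧ ∑ j, A j ⊗ₖ B j = r • X := by
  obtain ⟨τ, _, w, z, hw, -, hz, rfl⟩ := mem_convexHull_iff_exists_fintype.1 hX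
  choose p hp hpz using hz
  refine ⟨τ, inferInstance,
    fun j => (r * w j) • Matrix.vecMulVec (p j).1.ofLp (star (p j).1.ofLp),
    fun j => Matrix.vecMulVec (p j).2.ofLp (star (p j).2.ofLp),
    fun j => (Matrix.posSemidef_vecMulVec_self_star _).smul (mul_nonneg hr (hw j)),
    fun j => Matrix.posSemidef_vecMulVec_self_star _, ?_⟩
  rw [Finset.smul_sum]
  refine Finset.sum_congr rfl fun j _ => ?_
  rw [Matrix.smul_kronecker, ← vecMulVec_prodVec, mul_smul, ← hpz]

/-- Traceless Hermitian operators of Hilbert–Schmidt norm at most one belong to the body of the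
separable measurements. -/
theorem mem_body_SEP_of_frobSq_le_one {a b : ℕ} [NeZero a] [NeZero b] {Δ : Op (Bi a b)}
    (hΔ : Δ.IsHermitian) (hΔ0 : Δ.trace = 0) (hΔ1 : frobSq Δ ≤ 1) : Δ ∈ body (SEP a b) := by
  have hD : (0 : ℝ) < Fintype.card (Bi a b) := by exact_mod_cast Fintype.card_pos
  have h2 := one_add_mem_convexHull hΔ.neg (by rw [Matrix.trace_neg, hΔ0, neg_zero])
    (by simpa [frobSq] using hΔ1)
  obtain ⟨τ, _, A, B, hA, hB, h⟩ := exists_sum_kronecker_of_mem_convexHull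
    (one_add_mem_convexHull hΔ hΔ0 hΔ1) (half_pos hD).le
  obtain ⟨τ', _, A', B', hA', hB', h'⟩ := exists_sum_kronecker_of_mem_convexHull h2 (half_pos hD).le
  have hc : (Fintype.card (Bi a b) : ℝ) / 2 * (Fintype.card (Bi a b) : ℝ)⁻¹ = 1 / 2 := by
    field_simp
  rw [smul_smul, hc] at h h'
  -- The separable decompositions of (1 + Δ)/2 and (1 − Δ)/2 together form one POVM; grouping the
  -- first family gives 2·(1 + Δ)/2 − 1 = Δ.
  obtain ⟨m, M, I, hM, hI⟩ := exists_mem_SEP (A := Sum.elim A A') (B := Sum.elim B B')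
    (fun j => by cases j <;> simp [hA, hA']) (fun j => by cases j <;> simp [hB, hB'])
    (by
      rw [Fintype.sum_sum_type]
      simp only [Sum.elim_inl, Sum.elim_inr]
      rw [h, h', ← smul_add, add_add_add_comm, add_neg_cancel, add_zero, ← two_smul ℝ, smul_smul]
      norm_num)
    (Finset.univ.map Function.Embedding.inl)
  rw [Finset.sum_map] at hI
  simp only [Function.Embedding.inl_apply, Sum.elim_inl] at hI
  have hmem := generator_mem_body hM I
  rw [← hI, h] at hmem
  convert hmem using 1
  ext p q
  simp only [Matrix.sub_apply, Matrix.smul_apply, Matrix.add_apply, smul_eq_mul, Complex.real_smul]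
  push_cast
  ring

/-- For ξ ≠ 0 the test operator is ξ/‖ξ‖₂, which lies in the body by the separable ball. -/
theorem sqrt_frobSq_le_bodyNorm_SEP {a b : ℕ} [NeZero a] [NeZero b] {ξ : Op (Bi a b)}
    (hξ : ξ.IsHermitian) (hξ' : ξ.trace = 0) :
    Real.sqrt (frobSq ξ) ≤ bodyNorm (body (SEP a b)) ξ := by
  rcases (Real.sqrt_nonneg (frobSq ξ)).eq_or_lt with h0 | h0
  · rw [← h0]
    exact bodyNorm_nonneg _ _
  set s := Real.sqrt (frobSq ξ)
  have hs : frobSq ξ = s ^ 2 := (Real.sq_sqrt (frobSq_nonneg ξ)).symm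
  have hΔ : (((s⁻¹ : ℝ) : ℂ) • ξ).IsHermitian := by
    rw [Matrix.IsHermitian, Matrix.conjTranspose_smul, hξ.eq, Complex.star_def,
      Complex.conj_ofReal]
  have hf : frobSq (((s⁻¹ : ℝ) : ℂ) • ξ) = s⁻¹ ^ 2 * frobSq ξ := by
    simp only [frobSq, Matrix.smul_apply, smul_eq_mul, norm_mul, mul_pow, Complex.norm_real,
      Real.norm_eq_abs, sq_abs, Finset.mul_sum]
  have hmem := mem_body_SEP_of_frobSq_le_one hΔ (by rw [Matrix.trace_smul, hξ', smul_zero])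
    (by rw [hf, hs, ← mul_pow, inv_mul_cancel₀ h0.ne', one_pow])
  refine le_trans (le_of_eq ?_) (le_bodyNorm isPOVM_of_mem_SEP hξ hξ' hmem)
  have ht : (ξ * ξ).trace = ((s ^ 2 : ℝ) : ℂ) := by
    rw [← hs, ← trace_conjTranspose_mul_self, hξ.eq]
  rw [Matrix.mul_smul, Matrix.trace_smul, ht, smul_eq_mul, ← Complex.ofReal_mul, Complex.norm_real,
    pow_two, inv_mul_cancel_left₀ h0.ne', Real.norm_of_nonneg h0.le]

/-! ### Comparison of the norms -/

section Comparison

variable {d : ℕ} {ξ : Op (Bi d d)}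

theorem traceNorm_le_mul_sqrt_frobSq (ξ : Op (Bi d d)) :
    traceNorm ξ ≤ d * Real.sqrt (frobSq ξ) := by
  refine (traceNorm_le_sqrt_card_mul ξ).trans (le_of_eq ?_)
  rw [Fintype.card_prod, Fintype.card_fin, Nat.cast_mul, Real.sqrt_mul_self (Nat.cast_nonneg d)]

theorem mul_traceNorm_le_continuousOutcomeNorm [NeZero d] (hξ : ξ.IsHermitian) :
    1 / (Real.sqrt 153 * (d : ℝ)) * traceNorm ξ ≤
      continuousOutcomeNorm ((uniformUnit d).prod (uniformUnit d))
        (fun ω : UnitVec d × UnitVec d => isotropic d ω.1 ⊗ₖ isotropic d ω.2) ξ := by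
  have hd : (0 : ℝ) < d := by exact_mod_cast Nat.pos_of_ne_zero (NeZero.ne d)
  refine le_trans ?_ (sqrt_frobSq_le_continuousOutcomeNorm hξ)
  -- The moment argument gives the constant 12 = √144, so there is room to spare.
  have h12 : (12 : ℝ) ≤ Real.sqrt 153 := Real.le_sqrt_of_sq_le (by norm_num)
  have hs : 0 < Real.sqrt 153 := by linarith
  rw [one_div_mul_eq_div]
  calc traceNorm ξ / (Real.sqrt 153 * d) ≤ d * Real.sqrt (frobSq ξ) / (Real.sqrt 153 * d) := by
        gcongr
        exact traceNorm_le_mul_sqrt_frobSq ξ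
    _ = Real.sqrt (frobSq ξ) / Real.sqrt 153 := by field_simp
    _ ≤ Real.sqrt (frobSq ξ) / 12 := by gcongr

theorem bodyNorm_LO_le_LOCC (hξ : ξ.IsHermitian) (hξ' : ξ.trace = 0) :
    bodyNorm (body (LO d d)) ξ ≤ bodyNorm (body (LOCC d d)) ξ :=
  bodyNorm_mono isPOVM_of_mem_LOCC
    (fun n M I hM => ⟨n, M, I, mem_LOCC_of_mem_LO n M hM, rfl⟩) hξ hξ'

theorem bodyNorm_LOCC_le_SEP (hξ : ξ.IsHermitian) (hξ' : ξ.trace = 0) :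
    bodyNorm (body (LOCC d d)) ξ ≤ bodyNorm (body (SEP d d)) ξ :=
  bodyNorm_mono isPOVM_of_mem_SEP exists_SEP_grouping_of_LOCC hξ hξ'

theorem bodyNorm_SEP_le_PPT (hξ : ξ.IsHermitian) (hξ' : ξ.trace = 0) :
    bodyNorm (body (SEP d d)) ξ ≤ bodyNorm (body (PPT d d)) ξ :=
  bodyNorm_mono isPOVM_of_mem_PPT
    (fun n M I hM => ⟨n, M, I, mem_PPT_of_mem_SEP n M hM, rfl⟩) hξ hξ'

theorem continuousOutcomeNorm_nonneg {ι Ω : Type} [Fintype ι] [MeasurableSpace Ω]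
    (μ : Measure Ω) (M : Ω → Op ι) (ξ : Op ι) : 0 ≤ continuousOutcomeNorm μ M ξ :=
  integral_nonneg fun _ => norm_nonneg _

theorem lam_chain (hd : 2 ≤ d) :
    1 / (Real.sqrt 153 * (d : ℝ)) ≤ lamUU d ∧ lamUU d ≤ lamSet (LO d d) ∧
      lamSet (LO d d) ≤ lamSet (LOCC d d) ∧ lamSet (LOCC d d) ≤ lamSet (SEP d d) ∧
      lamSet (SEP d d) ≤ lamSet (PPT d d) ∧ lamSet (PPT d d) ≤ 2 / ((d : ℝ) + 1) := by
  have : NeZero d := ⟨by omega⟩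
  have h1 := isHermitian_hidingDiff hd
  have h2 := trace_hidingDiff hd
  have h3 : 0 < traceNorm (hidingDiff d) := by rw [traceNorm_hidingDiff hd]; norm_num
  refine ⟨le_lowerDomination h1 h2 h3 fun ξ hξ _ => mul_traceNorm_le_continuousOutcomeNorm hξ,
    lowerDomination_mono h1 h2 h3 (continuousOutcomeNorm_nonneg _ _)
      fun ξ hξ hξ' => continuousOutcomeNorm_le_bodyNorm_LO hξ hξ',
    lowerDomination_mono h1 h2 h3 (bodyNorm_nonneg _) fun ξ => bodyNorm_LO_le_LOCC,
    lowerDomination_mono h1 h2 h3 (bodyNorm_nonneg _) fun ξ => bodyNorm_LOCC_le_SEP,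
    lowerDomination_mono h1 h2 h3 (bodyNorm_nonneg _) fun ξ => bodyNorm_SEP_le_PPT,
    lowerDomination_le h1 h2 h3 (bodyNorm_nonneg _) ?_⟩
  rw [traceNorm_hidingDiff hd]
  exact bodyNorm_PPT_hidingDiff_le hd

theorem one_div_le_lamSet_SEP (hd : 2 ≤ d) : 1 / (d : ℝ) ≤ lamSet (SEP d d) := by
  have : NeZero d := ⟨by omega⟩
  have hd0 : (0 : ℝ) < d := by exact_mod_cast Nat.pos_of_ne_zero (NeZero.ne d)
  refine le_lowerDomination (isHermitian_hidingDiff hd) (trace_hidingDiff hd)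
    (by rw [traceNorm_hidingDiff hd]; norm_num) fun ξ hξ hξ' => ?_
  refine le_trans ?_ (sqrt_frobSq_le_bodyNorm_SEP hξ hξ')
  rw [one_div_mul_eq_div, div_le_iff₀ hd0, mul_comm]
  exact traceNorm_le_mul_sqrt_frobSq ξ

theorem le_optimalBias_LOCC (hd : 2 ≤ d) {ρ σ : Op (Bi d d)} (hρ : IsState ρ) (hσ : IsState σ)
    (h : ρ * σ = 0) : 1 / (Real.sqrt 153 * (d : ℝ)) ≤ optimalBias (LOCC d d) ρ σ := by
  have : NeZero d := ⟨by omega⟩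
  have h1 : (ρ - σ).IsHermitian := hρ.1.1.sub hσ.1.1
  have h2 : (ρ - σ).trace = 0 := by rw [Matrix.trace_sub, hρ.2, hσ.2, sub_self]
  have h3 := mul_traceNorm_le_continuousOutcomeNorm h1
  rw [traceNorm_sub_of_orthogonal hρ hσ h] at h3
  rw [optimalBias, povmSetNorm_eq_bodyNorm isPOVM_of_mem_LOCC h1 h2, le_div_iff₀ two_pos]
  exact h3.trans ((continuousOutcomeNorm_le_bodyNorm_LO h1 h2).trans (bodyNorm_LO_le_LOCC h1 h2))

theorem optimalBias_LOCC_hiding_le (hd : 2 ≤ d) :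
    optimalBias (LOCC d d) (symState d) (antisymState d) ≤ 2 / ((d : ℝ) + 1) := by
  have h1 := isHermitian_hidingDiff hd
  have h2 := trace_hidingDiff hd
  change povmSetNorm (LOCC d d) (hidingDiff d) / 2 ≤ _
  rw [povmSetNorm_eq_bodyNorm isPOVM_of_mem_LOCC h1 h2, div_le_iff₀ two_pos]
  exact (bodyNorm_LOCC_le_SEP h1 h2).trans
    ((bodyNorm_SEP_le_PPT h1 h2).trans (bodyNorm_PPT_hidingDiff_le hd))

theorem le_worstBias_LOCC (hd : 2 ≤ d) :
    1 / (Real.sqrt 153 * (d : ℝ)) ≤ worstBias (LOCC d d) :=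
  le_csInf ⟨_, symState d, antisymState d, isState_symState hd, isState_antisymState hd,
    symState_mul_antisymState, rfl⟩ fun r hr => by
      obtain ⟨ρ, σ, hρ, hσ, h, rfl⟩ := hr
      exact le_optimalBias_LOCC hd hρ hσ h

theorem worstBias_LOCC_le (hd : 2 ≤ d) : worstBias (LOCC d d) ≤ 2 / ((d : ℝ) + 1) := by
  -- The universal lower bound on the bias shows that the infimum is over a set bounded below.
  refine le_trans (csInf_le ⟨1 / (Real.sqrt 153 * (d : ℝ)), ?_⟩ ⟨symState d, antisymState d,
    isState_symState hd, isState_antisymState hd, symState_mul_antisymState, rfl⟩)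
    (optimalBias_LOCC_hiding_le hd)
  rintro r ⟨ρ, σ, hρ, hσ, h, rfl⟩
  exact le_optimalBias_LOCC hd hρ hσ h

end Comparison

theorem isTheta_one_div_of_le {f : ℕ → ℝ} {c C : ℝ} (hc : 0 < c) (hC : 0 ≤ C)
    (h1 : ∀ d : ℕ, 2 ≤ d → 1 / (c * (d : ℝ)) ≤ f d)
    (h2 : ∀ d : ℕ, 2 ≤ d → f d ≤ C / ((d : ℝ) + 1)) :
    f =Θ[atTop] fun d : ℕ => 1 / (d : ℝ) := by
  refine ⟨Asymptotics.IsBigO.of_bound C ?_, Asymptotics.IsBigO.of_bound c ?_⟩ <;>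
    filter_upwards [eventually_ge_atTop 2] with d hd <;>
    have hd0 : (0 : ℝ) < d := by exact_mod_cast (by omega : 0 < d)
  · have h0 : 0 ≤ f d := le_trans (by positivity) (h1 d hd)
    rw [Real.norm_of_nonneg h0, Real.norm_of_nonneg (by positivity), mul_one_div]
    refine (h2 d hd).trans ?_
    gcongr
    linarith
  · have h0 : 0 ≤ f d := le_trans (by positivity) (h1 d hd)
    rw [Real.norm_of_nonneg h0, Real.norm_of_nonneg (by positivity)]
    refine le_trans (le_of_eq ?_) (mul_le_mul_of_nonneg_left (h1 d hd) hc.le)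
    field_simp

end LocalMeas

end

theorem mainTheorem2 :
    (∀ d : ℕ, 2 ≤ d →
      (1 / (Real.sqrt 153 * (d : ℝ)) ≤ lamUU d ∧
        lamUU d ≤ lamSet (LO d d) ∧
        lamSet (LO d d) ≤ lamSet (LOCC d d) ∧
        lamSet (LOCC d d) ≤ lamSet (SEP d d) ∧
        lamSet (SEP d d) ≤ lamSet (PPT d d) ∧
        lamSet (PPT d d) ≤ 2 / ((d : ℝ) + 1)) ∧
      1 / (d : ℝ) ≤ lamSet (SEP d d) ∧
      (∀ ρ σ : Op (Bi d d), IsState ρ → IsState σ → ρ * σ = 0 →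
        1 / (Real.sqrt 153 * (d : ℝ)) ≤ optimalBias (LOCC d d) ρ σ) ∧
      (IsState (symState d) ∧ IsState (antisymState d) ∧ symState d * antisymState d = 0 ∧
        optimalBias (LOCC d d) (symState d) (antisymState d) ≤ 2 / ((d : ℝ) + 1))) ∧
    ((fun d : ℕ => lamSet (LOCC d d)) =Θ[atTop] fun d : ℕ => 1 / (d : ℝ)) ∧
    ((fun d : ℕ => worstBias (LOCC d d)) =Θ[atTop] fun d : ℕ => 1 / (d : ℝ)) ∧
    ((fun d : ℕ => optimalBias (LOCC d d) (symState d) (antisymState d)) =Θ[atTop]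
      fun d : ℕ => 1 / (d : ℝ)) := by
  have hs : 0 < Real.sqrt 153 := Real.sqrt_pos.2 (by norm_num)
  refine ⟨fun d hd => ⟨lam_chain hd, one_div_le_lamSet_SEP hd,
    fun ρ σ => le_optimalBias_LOCC hd, isState_symState hd, isState_antisymState hd,
    symState_mul_antisymState, optimalBias_LOCC_hiding_le hd⟩,
    isTheta_one_div_of_le hs zero_le_two (fun d hd => ?_) (fun d hd => ?_),
    isTheta_one_div_of_le hs zero_le_two (fun d hd => le_worstBias_LOCC hd)
      (fun d hd => worstBias_LOCC_le hd),
    isTheta_one_div_of_le hs zero_le_two (fun d hd => le_optimalBias_LOCC hd (isState_symState hd)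
      (isState_antisymState hd) symState_mul_antisymState)
      (fun d hd => optimalBias_LOCC_hiding_le hd)⟩
  · obtain ⟨h1, h2, h3, -⟩ := lam_chain hd
    exact h1.trans (h2.trans h3)
  · obtain ⟨-, -, -, h4, h5, h6⟩ := lam_chain hd
    exact h4.trans (h5.trans h6)
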